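/- **Setting.** Let $F_0$ be a non-archimedean local field of residual characteristic $\neq 2$ with normalized valuation $v$ ($v(F_0^\times)=\mathbb Z$), $F/F_0$ a Galois extension of degree $\le 2$, $\sigma$ a generator of $\mathrm{Gal}(F/F_0)$, and write $v$ also for the extension of $v$ to any finite extension of $F_0$. Let $V$ be a finite-dimensional $F$-vector space with a non-degenerate $\epsilon$-hermitian form $h$ relative to $\sigma$ ($\epsilon=\pm1$), $a\mapsto a^\sigma$ the adjunction on $\mathrm{End}_F(V)$ and $G$ the isometry group of $h$. Let $\beta\in \mathrm{End}_F(V)$ with $\beta^\sigma=-\beta$ be such that $F[\beta]=\bigoplus_i E_i$ is a direct sum of fields, with idempotents $\mathbf 1_i$; label the indices so that $\mathbf 1_i^\sigma=\mathbf 1_{-i}$, put $V_i=\mathbf 1_iV$ (an $E_i$-vector space), let $J_o$ be the set of $i$ with $-i=i$, and let $J_+$ contain exactly one of $i,-i$ for each $i\notin J_o$. For $i\in J_o$ let $\sigma_i$ be the restriction of the adjunction to $E_i$ and $E_i^o$ its fixed field, let $\lambda_i:E_i\to F$ be a non-zero $F$-linear form with $\lambda_i\circ\sigma_i=\sigma\circ\lambda_i$,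 and let $\lambda_i^o:E_i^o\to F_0$ be the $F_0$-linear form such that $\lambda_i^o\circ\mathrm{Tr}_{E_i/E_i^o}=\mathrm{Tr}_{F/F_0}\circ\lambda_i$. Assume $\lambda_i$ normalized by $\{e\in E_i^o: \lambda_i^o(e\,\mathfrak o_{E_i^o})\subset\mathfrak p_{F_0}\}=\mathfrak p_{E_i^o}$. Let $h_i$ be the $\epsilon$-hermitian form on $V_i$ relative to $\sigma_i$ with $h=\lambda_i\circ h_i$ on $V_i$, and $H_i$ its isometry group. For $i\in J_+$ let $H_i=\mathrm{Aut}_{E_i}(V_i)$. For a finite extension $K$ of $F_0$, a lattice function in a finite-dimensional $K$-vector space $W$ is a decreasing left-continuous map $\Lambda$ from $\mathbb R$ to the $\mathfrak o_K$-lattices of $W$ with $\Lambda(r+v(\pi_K))=\mathfrak p_K\Lambda(r)$, where $\pi_K$ is a uniformizer; $\mathrm{Latt}^1_{\mathfrak o_K}(W)$ is the set of these. Put $\Lambda(r+)=\bigcup_{s>r}\Lambda(s)$. For a form $f$ on $W$, $\Lambda$ is self-dual if $\Lambda(r)=\{x: f(x,\Lambda((-r)+))\subset\mathfrak p_K\}$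 for all $r$, and $\mathrm{Latt}^1_{\mathfrak o_K,f}(W)$ is the set of these. If a basis $(e_k)$ splits $\Lambda$ and $M$, i.e. $\Lambda(r)=\bigoplus_k\{c\in K: v(c)\ge r+l_k\}e_k$ and $M(r)=\bigoplus_k\{c\in K:v(c)\ge r+m_k\}e_k$ for all $r$, then $t\Lambda+(1-t)M$ is the lattice function split by $(e_k)$ with constants $tl_k+(1-t)m_k$. Barycenters of two points of a building are computed in an apartment containing both. Let $I$ be the Bruhat–Tits building of $G$ and $j_h:I\to\mathrm{Latt}^1_{\mathfrak o_F,h}(V)$ the affine $G$-equivariant bijection. Let $I_i$ be the building of $H_i$ and $j_{h_i}:I_i\to\mathrm{Latt}^1_{\mathfrak o_{E_i},h_i}(V_i)$ the affine $H_i$-equivariant bijection for $i\in J_o$; for $i\in J_+$ let $I_i$ be the enlarged building of $H_i$ and $j_i:I_i\to\mathrm{Latt}^1_{\mathfrak o_{E_i}}(V_i)$ any affine $H_i$-equivariant bijection. Here a bijection is called affine if it and its inverse preserve barycenters. Let $I^1_\beta=\prod_{i\in J_o\cup J_+}I_i$, with componentwise barycenters. **Proposition 7.1.** There is a unique map $j_\beta:I^1_\beta\to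 I$ such that, for $x=(x_i)$ in $I^1_\beta$, $$j_h(j_\beta(x))=\bigoplus_{i}\Lambda_i ,$$ where $\Lambda_i=j_{h_i}(x_i)$ for $i\in J_o$, and, for $i\in J_+$, $\Lambda_i=j_i(x_i)$ and $\Lambda_{-i}(r)=\{u\in V_{-i}: h(u,\Lambda_i((-r)+))\subset\mathfrak p_F\}$ for $r\in\mathbb R$. This map is affine: for all $x,y\in I^1_\beta$ and $t\in[0,1]$, $$j_\beta(tx+(1-t)y)=t\,j_\beta(x)+(1-t)\,j_\beta(y).$$ -/

import Mathlib

namespace BruhatTits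

noncomputable section

/-! ## Lattice functions -/

/-- The valuation ring `{x | 0 ≤ v x}` of an additive valuation. -/
def ringOfIntegers {K : Type*} [Field K] (v : AddValuation K (WithTop ℝ)) : Subring K where
  carrier := {x | 0 ≤ v x}
  zero_mem' := by simp
  one_mem' := by simp
  add_mem' := fun {a b} ha hb => le_trans (le_min ha hb) (v.map_add a b)
  mul_mem' := fun {a b} ha hb => by
    have h : v (a * b) = v a + v b := v.map_mul a b
    show 0 ≤ v (a * b)
    rw [h]
    exact add_nonneg ha hb
  neg_mem' := fun {a} ha => by
    show 0 ≤ v (-a)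
    rw [v.map_neg]
    exact ha

/-- A lattice function in the `K`-vector space `W`: a decreasing, left-continuous family
`(Λ(r))_{r ∈ ℝ}` of lattices (finitely generated submodules over the ring of integers which span
`W`) such that `Λ(r + v(c)) = c Λ(r)` for all `c ∈ Kˣ`. For `c` a uniformizer the last condition
is `Λ(r + v(π)) = 𝔭 Λ(r)`, and for `c` a unit it only says that `Λ(r)` is a module over the ring of
integers. -/
@[ext]
structure LatticeFunction {K : Type*} [Field K] (v : AddValuation K (WithTop ℝ))
    (W : Type*) [AddCommGroup W] [Module K W] where
  toFun : ℝ → Submodule (ringOfIntegers v) W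
  fg : ∀ r, (toFun r).FG
  span_eq_top : ∀ r, Submodule.span K (toFun r : Set W) = ⊤
  anti : ∀ r s, s ≤ r → toFun r ≤ toFun s
  scale : ∀ (c : K) (s : ℝ), v c = (s : WithTop ℝ) →
    ∀ (r : ℝ) (x : W), c • x ∈ toFun (r + s) ↔ x ∈ toFun r
  left_cont : ∀ (r : ℝ) (x : W), (∀ s, s < r → x ∈ toFun s) → x ∈ toFun r

namespace LatticeFunction

variable {K : Type*} [Field K] {v : AddValuation K (WithTop ℝ)}
  {W : Type*} [AddCommGroup W] [Module K W]

/-- `Λ(r+) = ⋃_{s > r} Λ(s)`. -/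
def plus (L : LatticeFunction v W) (r : ℝ) : Set W := {x | ∃ s, r < s ∧ x ∈ L.toFun s}

/-- The basis `b` splits `Λ` with constants `l`: `Λ(r) = ⨁ₖ {c | v(c) ≥ r + lₖ} bₖ`. -/
def SplitBy (L : LatticeFunction v W) {n : ℕ} (b : Module.Basis (Fin n) K W)
    (l : Fin n → ℝ) : Prop :=
  ∀ (r : ℝ) (x : W), x ∈ L.toFun r ↔ ∀ k, ((r + l k : ℝ) : WithTop ℝ) ≤ v (b.repr x k)

/-- `N` is the barycenter `t L + (1 - t) M`: some basis splits `L` and `M`, and splits `N` with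
constants the corresponding barycenters of the constants of `L` and `M`. -/
def IsBarycenter (t : ℝ) (L M N : LatticeFunction v W) : Prop :=
  ∃ (n : ℕ) (b : Module.Basis (Fin n) K W) (l m : Fin n → ℝ),
    L.SplitBy b l ∧ M.SplitBy b m ∧ N.SplitBy b (t • l + (1 - t) • m)

/-- `Λ' = gΛ`, that is `Λ'(r) = g(Λ(r))` for all `r`. -/
def IsTranslate (g : W ≃ₗ[K] W) (L L' : LatticeFunction v W) : Prop :=
  ∀ r, (L'.toFun r : Set W) = g '' (L.toFun r : Set W)

/-- `Λ` is self-dual for the form `h`: `Λ(r) = {x | h(x, Λ((-r)+)) ⊆ 𝔭}` for all `r`. -/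
def IsSelfDual {σ : K →+* K} (h : W →ₛₗ[σ] W →ₗ[K] K) (L : LatticeFunction v W) : Prop :=
  ∀ (r : ℝ) (x : W), x ∈ L.toFun r ↔ ∀ y ∈ L.plus (-r), 0 < v (h x y)

end LatticeFunction

/-! ## The enlarged building of the general linear group -/

section GeneralLinear

variable {K : Type*} [Field K] (v : AddValuation K (WithTop ℝ))
  {W : Type*} [AddCommGroup W] [Module K W] {n : ℕ} (b : Module.Basis (Fin n) K W)

/-- `n` permutes the lines `K bᵢ` and maps the point `p` of the standard apartment `ℝⁿ` to `q`:
if `g bᵢ = cᵢ b_{w(i)}` then `q_{w(i)} = pᵢ + v(cᵢ)`. -/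
def GLMonomial (g : W ≃ₗ[K] W) (p q : Fin n → ℝ) : Prop :=
  ∃ (w : Equiv.Perm (Fin n)) (c : Fin n → K),
    ∀ i, g (b i) = c i • b (w i) ∧ ((q (w i) : ℝ) : WithTop ℝ) = ((p i : ℝ) : WithTop ℝ) + v (c i)

/-- The union, over all roots `a`, of the terms `U_{a,p}` at `p` of the filtrations of the root
groups `U_a`: elementary transvections `bⱼ ↦ bⱼ + z bᵢ` with `v(z) ≥ pᵢ - pⱼ`. -/
def glRootElements (p : Fin n → ℝ) : Set (W ≃ₗ[K] W) :=
  {u | ∃ i j, i ≠ j ∧ ∃ z : K, ((p i - p j : ℝ) : WithTop ℝ) ≤ v z ∧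
    u (b j) = b j + z • b i ∧ ∀ k, k ≠ j → u (b k) = b k}

/-- `(g, p) ∼ (g', q)` if there is `n` in the monomial group with `q = n p` and `g⁻¹ g' n ∈ U_p`. -/
def glRel (x y : (W ≃ₗ[K] W) × (Fin n → ℝ)) : Prop :=
  ∃ m : W ≃ₗ[K] W, GLMonomial v b m x.2 y.2 ∧
    x.1⁻¹ * y.1 * m ∈ Subgroup.closure (glRootElements v b x.2)

/-- The enlarged Bruhat–Tits building of `GL(W)`: the quotient of `GL(W) × ℝⁿ` by `glRel`. -/
def GLBuilding : Type _ := Quot (glRel v b)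

namespace GLBuilding

/-- The class of `(g, p)`, i.e. the image under `g` of the point `p` of the standard apartment. -/
def mk (g : W ≃ₗ[K] W) (p : Fin n → ℝ) : GLBuilding v b := Quot.mk _ (g, p)

variable {v b}

/-- The action of `GL(W)` on its enlarged building. -/
def act (g : W ≃ₗ[K] W) : GLBuilding v b → GLBuilding v b :=
  Quot.map (fun x => (g * x.1, x.2)) (by
    rintro x y ⟨m, hm, hx⟩
    refine ⟨m, hm, ?_⟩
    have : (g * x.1)⁻¹ * (g * y.1) * m = x.1⁻¹ * y.1 * m := by group
    rw [this]
    exact hx)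

/-- `z = t x + (1 - t) y`, computed in some apartment containing the points. -/
def IsBarycenter (t : ℝ) (x y z : GLBuilding v b) : Prop :=
  ∃ (g : W ≃ₗ[K] W) (p q : Fin n → ℝ),
    x = mk v b g p ∧ y = mk v b g q ∧ z = mk v b g (t • p + (1 - t) • q)

/-- `j` is an affine and `GL(W)`-equivariant bijection from the enlarged building of `GL(W)` onto
the set of lattice functions in `W`. -/
structure IsIdentification (j : GLBuilding v b → LatticeFunction v W) : Prop where
  bijective : Function.Bijective j
  equivariant : ∀ (g : W ≃ₗ[K] W) (x : GLBuilding v b),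
    LatticeFunction.IsTranslate g (j x) (j (act g x))
  affine : ∀ t : ℝ, 0 ≤ t → t ≤ 1 → ∀ x y z : GLBuilding v b,
    IsBarycenter t x y z ↔ LatticeFunction.IsBarycenter t (j x) (j y) (j z)

end GLBuilding

end GeneralLinear

/-! ## The building of the isometry group of an `ε`-hermitian form -/

section Hermitian

variable {K : Type*} [Field K] {W : Type*} [AddCommGroup W] [Module K W] {σ : K →+* K}

/-- `h` is `ε`-hermitian: `h(y,x) = ε σ(h(x,y))`. -/
def IsEpsHermitian (ε : ℤˣ) (h : W →ₛₗ[σ] W →ₗ[K] K) : Prop :=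
  ∀ x y, h y x = ((ε : ℤ) : K) * σ (h x y)

/-- The group of isometries of `h`. -/
def isometryGroup (h : W →ₛₗ[σ] W →ₗ[K] K) : Subgroup (W ≃ₗ[K] W) where
  carrier := {g | ∀ x y, h (g x) (g y) = h x y}
  one_mem' := fun _ _ => rfl
  mul_mem' := fun {a c} ha hc x y => (ha (c x) (c y)).trans (hc x y)
  inv_mem' := fun {a} ha x y => by
    have h1 := ha (a⁻¹ x) (a⁻¹ y)
    have h2 : ∀ z, a (a⁻¹ z) = z := fun z => a.apply_symm_apply z
    rw [h2, h2] at h1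
    exact h1.symm

/-- A Witt decomposition for `h`. The vectors `e (inl i)` and `e (inr i)` are `eᵢ` and `e₋ᵢ`, and
the index `-i` is `i.swap`. -/
structure WittDecomposition (h : W →ₛₗ[σ] W →ₗ[K] K) where
  r : ℕ
  e : Fin r ⊕ Fin r → W
  orthogonal : ∀ i j, j ≠ i.swap → h (e i) (e j) = 0
  pairing : ∀ i : Fin r, h (e (Sum.inl i)) (e (Sum.inr i)) = 1
  anisotropic : ∀ x, (∀ i, h (e i) x = 0) → x ≠ 0 → h x x ≠ 0

namespace WittDecomposition

variable (v : AddValuation K (WithTop ℝ)) {h : W →ₛₗ[σ] W →ₗ[K] K} (w : WittDecomposition h)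

/-- The anisotropic part `V₀ = (V₊ + V₋)^⊥`. -/
def anisotropicPart : Submodule K W := ⨅ i, LinearMap.ker (h (w.e i))

/-- The apartment is `Hom(X^*(S), ℝ) = ℝʳ`, with coordinates `aᵢ`, `i > 0`; the function `aᵢ` for
an arbitrary index `i`, with `a₋ᵢ = -aᵢ`. -/
def coord (p : Fin w.r → ℝ) : Fin w.r ⊕ Fin w.r → ℝ := Sum.elim p (fun i => -p i)

/-- `g` permutes the lines `K eᵢ` and maps the point `p` of the apartment to `q`:
if `g eᵢ = cᵢ e_{π(i)}` then `a_{π(i)}(q) = aᵢ(p) + v(cᵢ)`. -/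
def Monomial (g : isometryGroup h) (p q : Fin w.r → ℝ) : Prop :=
  ∃ (π : Equiv.Perm (Fin w.r ⊕ Fin w.r)) (c : Fin w.r ⊕ Fin w.r → K),
    ∀ i, g.1 (w.e i) = c i • w.e (π i) ∧
      ((w.coord q (π i) : ℝ) : WithTop ℝ) = ((w.coord p i : ℝ) : WithTop ℝ) + v (c i)

/-- The terms at `p` of the filtrations of the root groups of the roots `± aᵢ ± aⱼ`, `i ≠ j`. -/
def longRootElements (p : Fin w.r → ℝ) : Set (isometryGroup h) :=
  {u | ∃ i j, j ≠ i ∧ j ≠ i.swap ∧ ∃ z z' : K,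
    ((w.coord p i - w.coord p j : ℝ) : WithTop ℝ) ≤ v z ∧
    u.1 (w.e j) = w.e j + z • w.e i ∧
    u.1 (w.e i.swap) = w.e i.swap + z' • w.e j.swap ∧
    (∀ k, k ≠ j → k ≠ i.swap → u.1 (w.e k) = w.e k) ∧
    ∀ x ∈ w.anisotropicPart, u.1 x = x}

/-- The terms at `p` of the filtrations of the root groups of the roots `± aᵢ` (which contain the
root groups of `± 2aᵢ`): the elements `u` with `u e₋ᵢ = e₋ᵢ + x₀ + k eᵢ` and `½ v(k) ≥ aᵢ(p)`. -/
def shortRootElements (p : Fin w.r → ℝ) : Set (isometryGroup h) :=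
  {u | ∃ i, ∃ x₀ ∈ w.anisotropicPart, ∃ k : K,
    ((2 * w.coord p i : ℝ) : WithTop ℝ) ≤ v k ∧
    u.1 (w.e i.swap) = w.e i.swap + x₀ + k • w.e i ∧
    (∀ j, j ≠ i.swap → u.1 (w.e j) = w.e j) ∧
    ∀ x ∈ w.anisotropicPart, ∃ c : K, u.1 x = x + c • w.e i}

/-- The subgroup `U_p` generated by the `U_{a,p}`, for all roots `a`. -/
def rootSubgroup (p : Fin w.r → ℝ) : Subgroup (isometryGroup h) :=
  Subgroup.closure (w.longRootElements v p ∪ w.shortRootElements v p)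

/-- `(g, p) ∼ (g', q)` if there is `n ∈ N` with `q = n p` and `g⁻¹ g' n ∈ U_p`. -/
def rel (x y : isometryGroup h × (Fin w.r → ℝ)) : Prop :=
  ∃ m : isometryGroup h, w.Monomial v m x.2 y.2 ∧ x.1⁻¹ * y.1 * m ∈ w.rootSubgroup v x.2

end WittDecomposition

/-- The Bruhat–Tits building of the isometry group `G` of `h`: the quotient of `G × A` by the
equivalence relation attached to the standard valuated root datum, `A = ℝʳ` being the apartment of
the Witt decomposition `w`. -/
def Building (v : AddValuation K (WithTop ℝ)) {h : W →ₛₗ[σ] W →ₗ[K] K}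
    (w : WittDecomposition h) : Type _ := Quot (w.rel v)

namespace Building

variable (v : AddValuation K (WithTop ℝ)) {h : W →ₛₗ[σ] W →ₗ[K] K} (w : WittDecomposition h)

/-- The class of `(g, p)`, i.e. the image under `g` of the point `p` of the standard apartment. -/
def mk (g : isometryGroup h) (p : Fin w.r → ℝ) : Building v w := Quot.mk _ (g, p)

variable {v w}

/-- The action of the isometry group on its building. -/
def act (g : isometryGroup h) : Building v w → Building v w :=
  Quot.map (fun x => (g * x.1, x.2)) (by
    rintro x y ⟨m, hm, hx⟩
    refine ⟨m, hm, ?_⟩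
    have : (g * x.1)⁻¹ * (g * y.1) * m = x.1⁻¹ * y.1 * m := by group
    rw [this]
    exact hx)

/-- `z = t x + (1 - t) y`, computed in some apartment containing the points. -/
def IsBarycenter (t : ℝ) (x y z : Building v w) : Prop :=
  ∃ (g : isometryGroup h) (p q : Fin w.r → ℝ),
    x = mk v w g p ∧ y = mk v w g q ∧ z = mk v w g (t • p + (1 - t) • q)

/-- `j` is an affine and equivariant bijection from the building of the isometry group of `h` onto
the set of self-dual lattice functions. -/
structure IsIdentification
    (j : Building v w → {L : LatticeFunction v W // L.IsSelfDual h}) : Prop where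
  bijective : Function.Bijective j
  equivariant : ∀ (g : isometryGroup h) (x : Building v w),
    LatticeFunction.IsTranslate g.1 (j x).1 (j (act g x)).1
  affine : ∀ t : ℝ, 0 ≤ t → t ≤ 1 → ∀ x y z : Building v w,
    IsBarycenter t x y z ↔ LatticeFunction.IsBarycenter t (j x).1 (j y).1 (j z).1

end Building

end Hermitian

/-! ## The algebra `F[β]` and the decomposition of `V` -/

section Centralizer

variable {F : Type*} [Field F] {V : Type*} [AddCommGroup V] [Module F V]
  {β : Module.End F V} {ι : Type*} [DecidableEq ι] {E : ι → Type*} [∀ i, Field (E i)]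
  [∀ i, Algebra F (E i)] (φ : Algebra.adjoin F {β} ≃ₐ[F] (∀ i, E i))

/-- The element of `F[β] ≃ ∏ Eᵢ` attached to `x ∈ Eᵢ`, as an endomorphism of `V`. -/
def embed (i : ι) (x : E i) : Module.End F V := (φ.symm (Pi.single i x) : Algebra.adjoin F {β})

/-- The idempotent `𝟏ᵢ` of `F[β]` attached to `Eᵢ`. -/
def idem (i : ι) : Module.End F V := embed φ i 1

theorem embed_add (i : ι) (x y : E i) : embed φ i (x + y) = embed φ i x + embed φ i y := by
  simp [embed, Pi.single_add]

theorem embed_mul (i : ι) (x y : E i) : embed φ i (x * y) = embed φ i x * embed φ i y := by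
  simp [embed, Pi.single_mul]

theorem embed_zero (i : ι) : embed φ i 0 = 0 := by
  simp [embed]

/-- The subspace `Vᵢ = 𝟏ᵢ V`. -/
def component (i : ι) : Submodule F V := LinearMap.range (idem φ i)

theorem embed_mem (i : ι) (x : E i) (u : V) : embed φ i x u ∈ component φ i :=
  ⟨embed φ i x u, by
    show (embed φ i 1 * embed φ i x) u = embed φ i x u
    rw [← embed_mul, one_mul]⟩

/-- The natural structure of `Eᵢ`-vector space on `Vᵢ`. -/
instance componentModule (i : ι) : Module (E i) (component φ i) where
  smul x u := ⟨embed φ i x u.1, embed_mem φ i x u.1⟩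
  one_smul := by
    rintro ⟨_, u, rfl⟩
    apply Subtype.ext
    show (embed φ i 1 * embed φ i 1) u = embed φ i 1 u
    rw [← embed_mul, one_mul]
  mul_smul x y u := by
    apply Subtype.ext
    show embed φ i (x * y) u.1 = embed φ i x (embed φ i y u.1)
    rw [embed_mul]
    rfl
  smul_zero x := Subtype.ext (map_zero (embed φ i x))
  smul_add x u u' := Subtype.ext (map_add (embed φ i x) u.1 u'.1)
  add_smul x y u := by
    apply Subtype.ext
    show embed φ i (x + y) u.1 = embed φ i x u.1 + embed φ i y u.1
    rw [embed_add]
    rfl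
  zero_smul u := by
    apply Subtype.ext
    show embed φ i 0 u.1 = 0
    rw [embed_zero]
    rfl

/-- The projection `V → Vᵢ`, `x ↦ 𝟏ᵢ x`. -/
def proj (i : ι) (x : V) : component φ i := ⟨idem φ i x, x, rfl⟩

/-- The map `ι_h`. Given `Λᵢ` for the indices `i` with `-i = i` and for `i ∈ J₊`, the family
`(Λᵢ)` over all `i` with `Λ₋ᵢ = Λᵢ^♯` for `i ∈ J₊`, where
`Λᵢ^♯(r) = {x ∈ V₋ᵢ | h(x, Λᵢ((-r)+)) ⊆ 𝔭_F}`. -/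
def iotaMap {σ : F →+* F} (h : V →ₛₗ[σ] V →ₗ[F] F) (v : AddValuation F (WithTop ℝ))
    (vE : ∀ i, AddValuation (E i) (WithTop ℝ)) (neg : ι → ι) (Jp : Set ι)
    (L₀ : ∀ i : {i // neg i = i}, LatticeFunction (vE i) (component φ i))
    (Lp : ∀ i : Jp, LatticeFunction (vE i) (component φ i)) (i : ι) (r : ℝ) :
    Set (component φ i) :=
  open Classical in
  if h₀ : neg i = i then (L₀ ⟨i, h₀⟩).toFun r
  else if hp : i ∈ Jp then (Lp ⟨i, hp⟩).toFun r
  else if hn : neg i ∈ Jp then {x | ∀ y ∈ (Lp ⟨neg i, hn⟩).plus (-r), 0 < v (h x.1 y.1)}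
  else ∅

/-- The map `(Λᵢ)ᵢ ↦ ⨁ᵢ Λᵢ`. -/
def directSum (L : ∀ i, ℝ → Set (component φ i)) (r : ℝ) : Set V := {x | ∀ i, proj φ i x ∈ L i r}

end Centralizer

end

end BruhatTits

open BruhatTits

/-! Since `jh` is bijective, `jβ` can only be the preimage under `jh` of `⨁ Λᵢ`. So uniqueness is
immediate, and existence amounts to `⨁ Λᵢ` being a self-dual lattice function. Self-duality: `Vᵢ`
pairs perfectly with `V₋ᵢ` and is orthogonal to the other components, so it suffices that `Λᵢ` is
the dual of `Λ₋ᵢ` for every `i` (`mem_directSum_iff_of_sharp`). If `-i ≠ i` this holds by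
construction or by biduality (`sharp_sharp_component`). If `-i = i`, duality for `hᵢ` has to become
duality for `λᵢ ∘ hᵢ`. This works because `λᵢ(a𝔬) ⊆ 𝔭` exactly when `a ∈ 𝔭`
(`LatticeFunction.IsSelfDual.eq_sharp`), a fact descended from the normalization of `λᵢ⁰` through
traces, where residual characteristic different from 2 enters (`pos_of_trace_pos`,
`lam_normalized`). Affineness: everything is expressed by bases and real constants, and each
operation acts on the constants in a way that respects barycenters. Restricting scalars from `Eᵢ` to
`F` multiplies a splitting basis by an `F`-basis of `Eᵢ` orthogonal for the valuation and translates
the constants (`LatticeFunction.IsBarycenter.isSplitBarycenter`). Duality passes to the dual basis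
and negates them (`sharp_splitSet`). The direct sum concatenates bases
(`IsSplitBarycenter.directSum`). Orthogonal bases come from Gram-Schmidt, the best approximations
being supplied by compactness of the balls of `F₀`. -/

namespace BruhatTits

/-! ## Norms on vector spaces over a valued field -/

section Norms

variable {K : Type*} [Field K] {v : AddValuation K (WithTop ℝ)}
  {W : Type*} [AddCommGroup W] [Module K W]

/-- An additive norm `α` on the vector space `W` over the valued field `(K, v)`. -/
structure IsNorm (v : AddValuation K (WithTop ℝ)) (α : W → WithTop ℝ) : Prop where
  eq_top_iff : ∀ x, α x = ⊤ ↔ x = 0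
  smul : ∀ (c : K) x, α (c • x) = v c + α x
  min_le_add : ∀ x y, min (α x) (α y) ≤ α (x + y)

/-- The family `e` is orthogonal for `α`: in fact `α (∑ cₖ eₖ) = minₖ (v(cₖ) + α(eₖ))`, the
other inequality being valid for every norm. -/
def IsOrthogonal (v : AddValuation K (WithTop ℝ)) (α : W → WithTop ℝ) {κ : Type*} [Fintype κ]
    (e : κ → W) : Prop :=
  ∀ (c : κ → K) (k : κ), α (∑ j, c j • e j) ≤ v (c k) + α (e k)

/-- The points of the subspace `s` approximate every vector of `W` best possibly. -/
def HasBestApprox (α : W → WithTop ℝ) (s : Submodule K W) : Prop :=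
  ∀ x, ∃ u ∈ s, ∀ y ∈ s, α (x - y) ≤ α (x - u)

namespace IsNorm

variable {α : W → WithTop ℝ}

theorem neg (hα : IsNorm v α) (x : W) : α (-x) = α x := by
  have h := hα.smul (-1) x
  rwa [v.map_neg, v.map_one, zero_add, neg_one_smul] at h

theorem min_le_sub (hα : IsNorm v α) (x y : W) : min (α x) (α y) ≤ α (x - y) := by
  have h := hα.min_le_add x (-y)
  rwa [hα.neg, ← sub_eq_add_neg] at h

theorem le_sum (hα : IsNorm v α) {κ : Type*} (s : Finset κ) (f : κ → W) (g : WithTop ℝ)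
    (h : ∀ k ∈ s, g ≤ α (f k)) : g ≤ α (∑ k ∈ s, f k) := by
  classical
  induction s using Finset.induction_on with
  | empty => simp [(hα.eq_top_iff 0).2 rfl]
  | insert a s ha ih =>
    rw [Finset.sum_insert ha]
    exact le_trans (le_min (h a (by simp)) (ih fun k hk => h k (by simp [hk])))
      (hα.min_le_add _ _)

/-- Orthogonality is used in this form: balls of the norm are products of balls in the coordinates.
-/
theorem le_sum_iff (hα : IsNorm v α) {κ : Type*} [Fintype κ] {e : κ → W}
    (he : IsOrthogonal v α e) (c : κ → K) (g : WithTop ℝ) :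
    g ≤ α (∑ k, c k • e k) ↔ ∀ k, g ≤ v (c k) + α (e k) := by
  refine ⟨fun h k => h.trans (he c k), fun h => hα.le_sum _ _ _ fun k _ => ?_⟩
  rw [hα.smul]
  exact h k

theorem exists_real (hα : IsNorm v α) {x : W} (hx : x ≠ 0) : ∃ r : ℝ, α x = r := by
  obtain ⟨r, hr⟩ := WithTop.ne_top_iff_exists.1 (mt (hα.eq_top_iff x).1 hx)
  exact ⟨r, hr.symm⟩

/-- Adding to an orthogonal family a vector which is not shortened by the vectors of its span. -/
theorem isOrthogonal_cons (hα : IsNorm v α) {n : ℕ} {e : Fin n → W} (he : IsOrthogonal v α e)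
    {x : W} (hx : ∀ u ∈ Submodule.span K (Set.range e), α (x - u) ≤ α x) :
    IsOrthogonal v α (Fin.cons x e : Fin (n + 1) → W) := by
  intro c
  have hsum : ∑ j, c j • (Fin.cons x e : Fin (n + 1) → W) j =
      c 0 • x + ∑ j : Fin n, c j.succ • e j := by
    simp [Fin.sum_univ_succ]
  rw [hsum]
  set y := ∑ j : Fin n, c j.succ • e j with hy
  have hmem : y ∈ Submodule.span K (Set.range e) :=
    Submodule.sum_mem _ fun j _ => Submodule.smul_mem _ _ (Submodule.subset_span ⟨j, rfl⟩)
  have h0 : α (c 0 • x + y) ≤ v (c 0) + α x := by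
    by_cases hc : c 0 = 0
    · simp [hc]
    · have h1 : c 0 • x + y = c 0 • (x - (-(c 0)⁻¹) • y) := by
        rw [smul_sub, smul_smul, mul_neg, mul_inv_cancel₀ hc, neg_one_smul, sub_neg_eq_add]
      rw [h1, hα.smul]
      gcongr
      exact hx _ (Submodule.smul_mem _ _ hmem)
  refine Fin.cases (by simpa using h0) fun k => ?_
  -- `y` is the difference of `c 0 • x + y` and `c 0 • x`, and by `h0` the first of these has the
  -- smaller value.
  have h2 : α (c 0 • x + y) ≤ α y := by
    have h3 := hα.min_le_sub (c 0 • x + y) (c 0 • x)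
    rw [add_sub_cancel_left, hα.smul, min_eq_left h0] at h3
    exact h3
  simpa using h2.trans (he (fun j => c j.succ) k)

/-- Gram-Schmidt orthogonalization. -/
theorem exists_isOrthogonal_span_eq (hα : IsNorm v α)
    (H : ∀ (n : ℕ) (e : Fin n → W), LinearIndependent K e → IsOrthogonal v α e →
      HasBestApprox α (Submodule.span K (Set.range e))) :
    ∀ (n : ℕ) (e : Fin n → W), LinearIndependent K e → ∃ f : Fin n → W,
      LinearIndependent K f ∧ IsOrthogonal v α f ∧
        Submodule.span K (Set.range f) = Submodule.span K (Set.range e) := by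
  intro n
  induction n with
  | zero => exact fun e he => ⟨e, he, fun _ k => k.elim0, rfl⟩
  | succ n ih =>
    intro e he
    obtain ⟨x, e, rfl⟩ : ∃ x e', (Fin.cons x e' : Fin (n + 1) → W) = e :=
      ⟨e 0, Fin.tail e, Fin.cons_self_tail e⟩
    rw [linearIndependent_finCons] at he
    obtain ⟨f, hf, hfo, hfe⟩ := ih e he.1
    -- Subtracting a best approximation from `x` makes `α` maximal on the coset, which is the
    -- hypothesis of `isOrthogonal_cons`. Best approximation is only required for spans of
    -- orthogonal families, since it is proved in orthogonal coordinates.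
    obtain ⟨u, hu, hux⟩ := H n f hf hfo x
    refine ⟨Fin.cons (x - u) f, ?_, hα.isOrthogonal_cons hfo fun y hy => ?_, ?_⟩
    · rw [linearIndependent_finCons]
      refine ⟨hf, fun h => he.2 ?_⟩
      rw [← hfe, ← sub_add_cancel x u]
      exact add_mem h hu
    · rw [sub_sub]
      exact hux _ (add_mem hu hy)
    · rw [Fin.range_cons, Fin.range_cons, Submodule.span_insert, Submodule.span_insert, hfe]
      rw [hfe] at hu
      apply le_antisymm
      · refine sup_le ?_ le_sup_right
        rw [Submodule.span_singleton_le_iff_mem]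
        exact sub_mem (Submodule.mem_sup_left (Submodule.mem_span_singleton_self x))
          (Submodule.mem_sup_right hu)
      · refine sup_le ?_ le_sup_right
        rw [Submodule.span_singleton_le_iff_mem]
        have h1 := add_mem (Submodule.mem_sup_left (Submodule.mem_span_singleton_self (x - u)))
          (Submodule.mem_sup_right hu)
        rwa [sub_add_cancel] at h1

theorem exists_orthogonal_basis (hα : IsNorm v α) [FiniteDimensional K W]
    (H : ∀ (n : ℕ) (e : Fin n → W), LinearIndependent K e → IsOrthogonal v α e →
      HasBestApprox α (Submodule.span K (Set.range e))) :
    ∃ b : Module.Basis (Fin (Module.finrank K W)) K W, IsOrthogonal v α b := by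
  obtain ⟨f, hf, hfo, hfs⟩ := hα.exists_isOrthogonal_span_eq H _ _
    (Module.finBasis K W).linearIndependent
  rw [Module.Basis.span_eq] at hfs
  exact ⟨Module.Basis.mk hf hfs.ge, by simpa using hfo⟩

/-! ### Best approximation from compactness of balls -/

section Compact

variable [TopologicalSpace K] [T2Space K] [ContinuousAdd K]
  (hK : ∀ r : ℝ, IsCompact {c : K | (r : WithTop ℝ) ≤ v c})

include hK

/-- The coefficient vectors that approximate `x` at least as well as a given one form a product of
balls, hence a compact set. These sets are nonempty and totally ordered by inclusion, so they have a
common point. -/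
theorem hasBestApprox_span (hα : IsNorm v α) {n : ℕ} {e : Fin n → W}
    (hl : LinearIndependent K e) (he : IsOrthogonal v α e) :
    HasBestApprox α (Submodule.span K (Set.range e)) := by
  intro x
  let f : (Fin n → K) → W := fun c => ∑ k, c k • e k
  have hf : ∀ c, f c ∈ Submodule.span K (Set.range e) := fun c =>
    Submodule.sum_mem _ fun j _ => Submodule.smul_mem _ _ (Submodule.subset_span ⟨j, rfl⟩)
  have hf' : ∀ y ∈ Submodule.span K (Set.range e), ∃ c, f c = y := fun y hy =>
    (Submodule.mem_span_range_iff_exists_fun K).1 hy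
  -- If `x` lies in the span it approximates itself; otherwise all the distances are finite and
  -- define balls of real radius.
  by_cases htop : ∃ c, x - f c = 0
  · obtain ⟨c, hc⟩ := htop
    exact ⟨f c, hf c, fun y _ => by rw [hc, (hα.eq_top_iff 0).2 rfl]; exact le_top⟩
  push Not at htop
  choose ρ hρ using fun c => hα.exists_real (htop c)
  choose a ha using fun k => hα.exists_real (hl.ne_zero k)
  let C : (Fin n → K) → Set (Fin n → K) := fun c => {d | α (x - f c) ≤ α (x - f d)}
  have hC : ∀ c, C c = Set.univ.pi fun k => {z | ((ρ c - a k : ℝ) : WithTop ℝ) ≤ v (z - c k)} := by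
    intro c
    ext d
    have h1 : f d - f c = ∑ k, (d k - c k) • e k := by
      simp [f, sub_smul]
    -- The ultrametric inequality eliminates `x`, leaving a condition on an element of the span.
    have h2 : d ∈ C c ↔ α (x - f c) ≤ α (f d - f c) := by
      constructor
      · intro h
        have h3 := hα.min_le_sub (x - f c) (x - f d)
        rwa [min_eq_left h, sub_sub_sub_cancel_left] at h3
      · intro h
        have h3 := hα.min_le_sub (x - f c) (f d - f c)
        rwa [min_eq_left h, sub_sub_sub_cancel_right] at h3
    rw [h2, h1, hα.le_sum_iff he, hρ]
    simp only [Set.mem_pi, Set.mem_univ, true_imp_iff, Set.mem_ofPred_eq]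
    refine forall_congr' fun k => ?_
    rw [ha]
    induction v (d k - c k) using WithTop.recTopCoe with
    | top => simp
    | coe z => norm_cast; constructor <;> intro <;> linarith
  have hcomp : ∀ c, IsCompact (C c) := by
    intro c
    rw [hC]
    refine isCompact_univ_pi fun k => ?_
    have h1 := (hK (ρ c - a k)).image (continuous_add_const (c k))
    convert h1 using 1
    ext z
    constructor
    · exact fun hz => ⟨z - c k, hz, sub_add_cancel _ _⟩
    · rintro ⟨y, hy, rfl⟩
      simpa using hy
  obtain ⟨d, hd⟩ := IsCompact.nonempty_iInter_of_directed_nonempty_isCompact_isClosed C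
    (by
      intro c c'
      rcases le_total (α (x - f c)) (α (x - f c')) with h | h
      · exact ⟨c', fun d hd => le_trans h hd, fun d hd => hd⟩
      · exact ⟨c, fun d hd => hd, fun d hd => le_trans h hd⟩)
    (fun c => ⟨c, le_refl (α (x - f c))⟩) hcomp (fun c => (hcomp c).isClosed)
  refine ⟨f d, hf d, fun y hy => ?_⟩
  obtain ⟨c, rfl⟩ := hf' y hy
  exact Set.mem_iInter.1 hd c

theorem hasBestApprox (hα : IsNorm v α) (s : Submodule K W) [FiniteDimensional K s] :
    HasBestApprox α s := by
  have hl : LinearIndependent K fun k => ((Module.finBasis K s k : s) : W) :=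
    (Module.finBasis K s).linearIndependent.map' s.subtype s.ker_subtype
  obtain ⟨f, hf, hfo, hfs⟩ := hα.exists_isOrthogonal_span_eq
    (fun _ _ hl ho => hα.hasBestApprox_span hK hl ho) _ _ hl
  have hs : Submodule.span K (Set.range fun k => ((Module.finBasis K s k : s) : W)) = s := by
    have h1 : (Set.range fun k => ((Module.finBasis K s k : s) : W)) =
        s.subtype '' Set.range (Module.finBasis K s) := by
      rw [← Set.range_comp]; rfl
    rw [h1, Submodule.span_image, Module.Basis.span_eq, Submodule.map_top, Submodule.range_subtype]
  rw [← hs, ← hfs]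
  exact hα.hasBestApprox_span hK hf hfo

end Compact

end IsNorm

theorem isNorm_addValuation {L : Type*} [Field L] [Algebra K L] {vL : AddValuation L (WithTop ℝ)}
    (hvL : ∀ x, vL (algebraMap K L x) = v x) : IsNorm v vL where
  eq_top_iff _ := vL.top_iff
  smul c x := by rw [Algebra.smul_def, vL.map_mul, hvL]
  min_le_add := vL.map_add

end Norms

/-! ## Finite extensions of local fields -/

section Valued

/-- The valuation `v` is discrete: every ball is of the form `{c | v(d) ≤ v(c)}`, `d ≠ 0`. -/
def IsDiscreteVal {K : Type*} [Field K] (v : AddValuation K (WithTop ℝ)) : Prop :=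
  ∀ a : ℝ, ∃ d : K, d ≠ 0 ∧ ∀ c, (a : WithTop ℝ) ≤ v c ↔ v d ≤ v c

theorem exists_val_eq_int {K : Type*} [Field K] {v : AddValuation K (WithTop ℝ)}
    (h1 : ∃ x : K, v x = ((1 : ℝ) : WithTop ℝ)) (k : ℤ) : ∃ d : K, v d = ((k : ℝ) : WithTop ℝ) := by
  obtain ⟨x, hx⟩ := h1
  have hn : ∀ n : ℕ, v (x ^ n) = ((n : ℝ) : WithTop ℝ) := by
    intro n
    induction n with
    | zero => simp
    | succ n ih => rw [pow_succ, v.map_mul, ih, hx]; push_cast; rfl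
  obtain ⟨n, rfl | rfl⟩ := k.eq_nat_or_neg
  · exact ⟨x ^ n, by simpa using hn n⟩
  · refine ⟨(x ^ n)⁻¹, ?_⟩
    rw [v.map_inv, hn]
    push_cast
    rfl

theorem isDiscreteVal_of_int {K : Type*} [Field K] {v : AddValuation K (WithTop ℝ)}
    (hint : ∀ x : K, x ≠ 0 → ∃ k : ℤ, v x = ((k : ℝ) : WithTop ℝ))
    (h1 : ∃ x : K, v x = ((1 : ℝ) : WithTop ℝ)) : IsDiscreteVal v := by
  intro a
  obtain ⟨d, hd⟩ := exists_val_eq_int h1 ⌈a⌉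
  refine ⟨d, ?_, fun c => ?_⟩
  · rintro rfl
    rw [v.map_zero] at hd
    exact WithTop.coe_ne_top hd.symm
  · by_cases hc : c = 0
    · simp [hc]
    · obtain ⟨k, hk⟩ := hint c hc
      rw [hk, hd]
      norm_cast
      exact Int.ceil_le.symm

/-- Discreteness turns a real radius into the value of an element `d`, so that the set is a closed
ball of the local field. -/
theorem isCompact_le_val {K : Type*} [Field K] [ValuativeRel K] [TopologicalSpace K]
    [IsNonarchimedeanLocalField K] {v : AddValuation K (WithTop ℝ)}
    (hv : ∀ x y : K, ValuativeRel.vle x y ↔ v y ≤ v x) (hd : IsDiscreteVal v) (r : ℝ) :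
    IsCompact {c : K | (r : WithTop ℝ) ≤ v c} := by
  obtain ⟨d, -, hd⟩ := hd r
  convert IsNonarchimedeanLocalField.isCompact_closedBall K (ValuativeRel.valuation K d) using 1
  ext c
  rw [Set.mem_ofPred_eq, Set.mem_ofPred_eq, hd, ← hv,
    Valuation.Compatible.vle_iff_le (v := ValuativeRel.valuation K)]

variable {K L M : Type*} [Field K] [Field L] [Field M] [Algebra K L] [Algebra L M] [Algebra K M]
  [IsScalarTower K L M] {v : AddValuation K (WithTop ℝ)} {vL : AddValuation L (WithTop ℝ)}
  {vM : AddValuation M (WithTop ℝ)} [TopologicalSpace K] [T2Space K] [ContinuousAdd K]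

/-- The valuation of `M` is a norm over both `K` and `L`, and an `L`-subspace is also a
`K`-subspace. Hence compactness of balls is needed over the bottom field only. -/
theorem exists_orthogonal_basis_of_tower
    (hK : ∀ r : ℝ, IsCompact {c : K | (r : WithTop ℝ) ≤ v c})
    (hvL : ∀ x, vL (algebraMap K L x) = v x) (hvM : ∀ x, vM (algebraMap L M x) = vL x)
    [FiniteDimensional K M] [FiniteDimensional L M] :
    ∃ b : Module.Basis (Fin (Module.finrank L M)) L M, IsOrthogonal vL vM b := by
  have hKM : IsNorm v vM := isNorm_addValuation fun x => by
    rw [IsScalarTower.algebraMap_apply K L M, hvM, hvL]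
  refine (isNorm_addValuation hvM).exists_orthogonal_basis fun n e _ _ => ?_
  exact hKM.hasBestApprox hK ((Submodule.span L (Set.range e)).restrictScalars K)

theorem exists_orthogonal_basis_of_compact
    (hK : ∀ r : ℝ, IsCompact {c : K | (r : WithTop ℝ) ≤ v c})
    (hvL : ∀ x, vL (algebraMap K L x) = v x) [FiniteDimensional K L] :
    ∃ b : Module.Basis (Fin (Module.finrank K L)) K L, IsOrthogonal v vL b :=
  exists_orthogonal_basis_of_tower (L := K) hK (fun _ => rfl) hvL

/-- In an orthogonal basis a ball of `L` is a product of balls of `K`, each having an element of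
least value. The least of these finitely many values is attained by a multiple of a basis vector. -/
theorem IsDiscreteVal.of_finite (hd : IsDiscreteVal v)
    (hK : ∀ r : ℝ, IsCompact {c : K | (r : WithTop ℝ) ≤ v c})
    (hvL : ∀ x, vL (algebraMap K L x) = v x) [FiniteDimensional K L] : IsDiscreteVal vL := by
  obtain ⟨b, hb⟩ := exists_orthogonal_basis_of_compact hK hvL
  have hn : IsNorm v vL := isNorm_addValuation hvL
  intro a
  choose β hβ using fun k => hn.exists_real (b.ne_zero k)
  choose d hd0 hd using fun k => hd (a - β k)
  have had : ∀ k (z : WithTop ℝ), ((a - β k : ℝ) : WithTop ℝ) ≤ z ↔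
      (a : WithTop ℝ) ≤ z + vL (b k) := by
    intro k z
    rw [hβ]
    induction z using WithTop.recTopCoe with
    | top => simp
    | coe z => norm_cast; constructor <;> intro <;> linarith
  have : Nonempty (Fin (Module.finrank K L)) := ⟨⟨0, Module.finrank_pos⟩⟩
  obtain ⟨k₀, -, hk₀⟩ := Finset.exists_min_image Finset.univ (fun k => vL (d k • b k))
    Finset.univ_nonempty
  refine ⟨d k₀ • b k₀, smul_ne_zero (hd0 _) (b.ne_zero _), fun c => ⟨fun hc => ?_, fun hc => ?_⟩⟩
  · rw [← b.sum_repr c] at hc ⊢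
    rw [hn.le_sum_iff hb] at hc ⊢
    intro k
    refine (hk₀ k (Finset.mem_univ k)).trans ?_
    rw [hn.smul]
    gcongr
    rw [← hd, had]
    exact hc k
  · refine le_trans ?_ hc
    rw [hn.smul, ← had, hd]

/-- The valuation of a complete field has at most one extension to a finite extension: it is
invariant under automorphisms. -/
theorem val_algEquiv (hK : ∀ r : ℝ, IsCompact {c : K | (r : WithTop ℝ) ≤ v c})
    (hvL : ∀ x, vL (algebraMap K L x) = v x) [FiniteDimensional K L] (τ : L ≃ₐ[K] L) (x : L) :
    vL (τ x) = vL x := by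
  obtain ⟨b, hb⟩ := exists_orthogonal_basis_of_compact hK hvL
  have hn : IsNorm v vL := isNorm_addValuation hvL
  have key : ∀ (τ : L ≃ₐ[K] L) (x : L), vL x ≤ vL (τ x) := by
    intro τ x
    by_cases hx : x = 0
    · simp [hx]
    have hτx : τ x ≠ 0 := by simpa using hx
    obtain ⟨r, hr⟩ := hn.exists_real hx
    obtain ⟨s, hs⟩ := hn.exists_real hτx
    choose β hβ using fun k => hn.exists_real (b.ne_zero k)
    choose γ hγ using fun k => hn.exists_real (x := τ (b k)) (by simpa using b.ne_zero k)
    obtain ⟨C, hC⟩ := (Set.finite_range fun k => β k - γ k).bddAbove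
    have hC' : ∀ k, β k - γ k ≤ C := fun k => hC ⟨k, rfl⟩
    -- `τ` lowers the value by at most a constant `C`: compare the two norms on the basis `b`, which
    -- is orthogonal for `vL`.
    have h1 : ∀ (y : L) (g : ℝ), (g : WithTop ℝ) ≤ vL y →
        ((g - C : ℝ) : WithTop ℝ) ≤ vL (τ y) := by
      intro y g hg
      rw [← b.sum_repr y] at hg
      rw [hn.le_sum_iff hb] at hg
      rw [← b.sum_repr y, map_sum]
      refine hn.le_sum _ _ _ fun k _ => ?_
      rw [map_smul, hn.smul, hγ]
      have h2 := hg k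
      rw [hβ] at h2
      have h3 := hC' k
      revert h2
      induction v (b.repr y k) using WithTop.recTopCoe with
      | top => simp
      | coe z => norm_cast; intro; linarith
    have hpow : ∀ (y : L) (t : ℝ) (n : ℕ), vL y = t → vL (y ^ n) = ((n * t : ℝ) : WithTop ℝ) := by
      intro y t n hy
      induction n with
      | zero => simp
      | succ n ih =>
        rw [pow_succ, vL.map_mul, ih, hy, ← WithTop.coe_add]
        congr 1
        push_cast
        ring
    -- Applying the bound to powers of `x` multiplies the defect `r - s` by `n` but leaves `C`
    -- unchanged, so the defect cannot be positive.
    have h2 : ∀ n : ℕ, n * (r - s) ≤ C := by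
      intro n
      have h3 := h1 (x ^ n) (n * r) (hpow x r n hr).ge
      rw [map_pow, hpow _ s n hs] at h3
      norm_cast at h3
      linarith
    rw [hr, hs]
    norm_cast
    by_contra hlt
    push Not at hlt
    obtain ⟨n, hn⟩ := exists_nat_gt (C / (r - s))
    rw [div_lt_iff₀ (by linarith)] at hn
    exact absurd (h2 n) (not_le.2 hn)
  refine le_antisymm ?_ (key τ x)
  simpa using key τ.symm (τ x)

end Valued

/-! ## Involutions and the trace -/

section Trace

/-- The factor `m` treats the trivial and the quadratic extension together: it is 2 when `τ = 1`,
where the trace is the identity, and 1 otherwise. It will be a unit, as 2 is. -/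
theorem smul_trace_eq {K L : Type*} [Field K] [Field L] [Algebra K L] [FiniteDimensional K L]
    [IsGalois K L] (τ : L ≃ₐ[K] L) (hτ : ∀ ρ : L ≃ₐ[K] L, ρ = 1 ∨ ρ = τ) :
    ∃ m : ℕ, (m = 1 ∨ m = 2) ∧ ∀ x, m * algebraMap K L (Algebra.trace K L x) = x + τ x := by
  classical
  by_cases h1 : τ = 1
  · refine ⟨2, Or.inr rfl, fun x => ?_⟩
    have hu : (Finset.univ : Finset (L ≃ₐ[K] L)) = {1} := by
      ext ρ
      have := hτ ρ
      simp_all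
    rw [trace_eq_sum_automorphisms, hu, h1]
    simp [two_mul]
  · refine ⟨1, Or.inl rfl, fun x => ?_⟩
    have hu : (Finset.univ : Finset (L ≃ₐ[K] L)) = {1, τ} := by
      ext ρ
      simpa using hτ ρ
    rw [trace_eq_sum_automorphisms, hu, Finset.sum_pair (Ne.symm h1)]
    simp

theorem eq_one_or_eq_of_mem_zpowers {G : Type*} [Group G] {g x : G} (hg : g * g = 1)
    (hx : x ∈ Subgroup.zpowers g) : x = 1 ∨ x = g := by
  obtain ⟨k, rfl⟩ := hx
  have h2 : g ^ (2 : ℤ) = 1 := by rw [zpow_two, hg]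
  obtain ⟨m, rfl | rfl⟩ := k.even_or_odd'
  · left
    simp [zpow_mul, h2]
  · right
    simp [zpow_add, zpow_mul, h2]

theorem smul_trace_fixedField_eq {K L : Type*} [Field K] [Field L] [Algebra K L]
    [FiniteDimensional K L] (τ : L ≃ₐ[K] L) (hτ : τ * τ = 1) :
    ∃ m : ℕ, (m = 1 ∨ m = 2) ∧ ∀ x,
      m * (Algebra.trace (IntermediateField.fixedField (Subgroup.zpowers τ)) L x : L) =
        x + τ x := by
  let S := IntermediateField.fixedField (Subgroup.zpowers τ)
  have hfix : IntermediateField.fixingSubgroup S = Subgroup.zpowers τ :=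
    IntermediateField.fixingSubgroup_fixedField _
  have hmem : τ ∈ IntermediateField.fixingSubgroup S := hfix ▸ Subgroup.mem_zpowers τ
  have : IsGalois S L := IsGalois.of_card_aut_eq_finrank S L (by
    rw [IntermediateField.finrank_fixedField_eq_card]
    exact Nat.card_congr (IntermediateField.subgroupEquivAlgEquiv _).symm.toEquiv)
  obtain ⟨m, hm, h⟩ := smul_trace_eq (K := S) (IntermediateField.fixingSubgroupEquiv S ⟨τ, hmem⟩)
    (fun ρ => by
      obtain ⟨⟨ρ, hρ⟩, rfl⟩ := (IntermediateField.fixingSubgroupEquiv S).surjective ρ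
      rcases eq_one_or_eq_of_mem_zpowers hτ (hfix ▸ hρ) with rfl | rfl
      · exact Or.inl (map_one (IntermediateField.fixingSubgroupEquiv S))
      · exact Or.inr rfl)
  exact ⟨m, hm, h⟩

variable {K : Type*} [Field K] {v : AddValuation K (WithTop ℝ)}

/-- Put `y = x - τ x`. If `y` has positive value, so does `2x = (x + τ x) + y`, hence also `x`.
Otherwise `y⁻¹` is integral, and as `τ y = -y`, the trace of `y⁻¹ x` is 1, which is excluded. -/
theorem pos_of_trace_pos {τ : K →+* K} (hτ : ∀ x, τ (τ x) = x) (h2 : v 2 = 0)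
    {x : K} (hx : ∀ c, 0 ≤ v c → 0 < v (c * x + τ (c * x))) : 0 < v x := by
  by_contra hneg
  set y := x - τ x with hy
  have hvy : v y ≤ 0 := by
    by_contra hlt
    push Not at hlt
    have h1 := hx 1 (by rw [v.map_one])
    have h3 := v.map_lt_add h1 hlt
    rw [one_mul, hy, add_add_sub_cancel, ← two_mul, v.map_mul, h2, zero_add] at h3
    exact hneg h3
  have hy0 : y ≠ 0 := by
    rintro h0
    rw [h0, v.map_zero] at hvy
    exact absurd hvy (by simp)
  have hτy : τ y = -y := by
    rw [hy, map_sub, hτ, neg_sub]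
  have h1 := hx y⁻¹ (by
    obtain ⟨r, hr⟩ := WithTop.ne_top_iff_exists.1 (v.ne_top_iff.2 hy0)
    rw [v.map_inv, ← hr]
    rw [← hr] at hvy
    have h3 : r ≤ 0 := by exact_mod_cast hvy
    have h4 : (0 : ℝ) ≤ -r := by linarith
    exact_mod_cast h4)
  have h3 : y⁻¹ * x + τ (y⁻¹ * x) = 1 := by
    rw [map_mul, map_inv₀, hτy, inv_neg, neg_mul, ← sub_eq_add_neg, ← mul_sub, ← hy,
      inv_mul_cancel₀ hy0]
  rw [h3, v.map_one] at h1
  exact lt_irrefl _ h1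

theorem val_natCast_mul {m : ℕ} (hm : m = 1 ∨ m = 2) (h2 : v 2 = 0) (x : K) :
    v (m * x) = v x := by
  rcases hm with rfl | rfl <;> simp [h2, v.map_mul]

/-- The normalization of `λ⁰` implies that `{a | λ(a 𝔬_E) ⊆ 𝔭_F} = 𝔭_E`. -/
theorem lam_normalized {F₀ F E : Type*} [Field F₀] [Field F] [Field E] [Algebra F₀ F]
    [Algebra F E] [Algebra F₀ E] [IsScalarTower F₀ F E] [FiniteDimensional F₀ F]
    [FiniteDimensional F₀ E] [IsGalois F₀ F]
    {v₀ : AddValuation F₀ (WithTop ℝ)} {v : AddValuation F (WithTop ℝ)}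
    {vE : AddValuation E (WithTop ℝ)} (hv : ∀ x, v (algebraMap F₀ F x) = v₀ x)
    (hvE : ∀ x, vE (algebraMap F E x) = v x) (hres : v₀ 2 = 0)
    (σ : F ≃ₐ[F₀] F) (hσ : ∀ ρ : F ≃ₐ[F₀] F, ρ ∈ Subgroup.zpowers σ) (hσ2 : σ * σ = 1)
    (hvσ : ∀ x, v (σ x) = v x)
    (σE : E ≃ₐ[F₀] E) (hσE2 : σE * σE = 1) (hvσE : ∀ x, vE (σE x) = vE x)
    (lam : E →ₗ[F] F)
    (lam₀ : IntermediateField.fixedField (Subgroup.zpowers σE) →ₗ[F₀] F₀)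
    (hlam₀ : ∀ a, lam₀ (Algebra.trace (IntermediateField.fixedField (Subgroup.zpowers σE)) E a) =
        Algebra.trace F₀ F (lam a))
    (hnorm : ∀ a : IntermediateField.fixedField (Subgroup.zpowers σE),
      (∀ c : IntermediateField.fixedField (Subgroup.zpowers σE),
        0 ≤ vE (c : E) → 0 < v₀ (lam₀ (a * c))) ↔ 0 < vE (a : E)) (a : E) :
    (∀ c, 0 ≤ vE c → 0 < v (lam (c * a))) ↔ 0 < vE a := by
  have h2F : v 2 = 0 := by rw [← map_ofNat (algebraMap F₀ F) 2, hv, hres]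
  have h2E : vE 2 = 0 := by rw [← map_ofNat (algebraMap F E) 2, hvE, h2F]
  obtain ⟨m, hm, htr⟩ := smul_trace_eq σ fun ρ => eq_one_or_eq_of_mem_zpowers hσ2 (hσ ρ)
  obtain ⟨mE, hmE, htrE⟩ := smul_trace_fixedField_eq σE hσE2
  have hσσ : ∀ x, σ (σ x) = x := fun x => DFunLike.congr_fun hσ2 x
  have hσEσE : ∀ x, σE (σE x) = x := fun x => DFunLike.congr_fun hσE2 x
  have hvtr : ∀ y : F, v (y + σ y) = v₀ (Algebra.trace F₀ F y) := fun y => by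
    rw [← htr, val_natCast_mul hm h2F, hv]
  have hvtrE : ∀ y : E, vE (y + σE y) =
      vE (Algebra.trace (IntermediateField.fixedField (Subgroup.zpowers σE)) E y : E) := fun y => by
    rw [← htrE, val_natCast_mul hmE h2E]
  constructor
  · intro h
    refine pos_of_trace_pos (τ := (σE : E →+* E)) hσEσE h2E fun d hd => ?_
    -- For integral `c` in the fixed field, `λ⁰(Tr(d a) c)` is the trace of `λ(c d a)`, which the
    -- hypothesis controls since `c d` is integral.
    change 0 < vE (d * a + σE (d * a))
    rw [hvtrE, ← hnorm]
    intro c hc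
    rw [mul_comm, ← smul_eq_mul, ← map_smul, hlam₀, ← hvtr]
    have h1 := h (c * d) (by rw [vE.map_mul]; exact add_nonneg hc hd)
    have h3 : c • (d * a) = c * d * a := by
      rw [mul_assoc]; rfl
    rw [h3]
    exact v.map_lt_add h1 (by rwa [hvσ])
  · intro h c hc
    have h1 : 0 < vE (c * a) := by
      rw [vE.map_mul]
      exact h.trans_le (le_add_of_nonneg_left hc)
    refine pos_of_trace_pos (τ := (σ : F →+* F)) hσσ h2F fun d hd => ?_
    -- Conversely the trace of `d λ(c a) = λ(d c a)` is `λ⁰` of a trace of positive value; the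
    -- normalization is applied with the multiplier 1.
    change 0 < v (d * lam (c * a) + σ (d * lam (c * a)))
    rw [hvtr, ← smul_eq_mul, ← map_smul, ← hlam₀]
    have h3 : 0 < vE (d • (c * a)) := by
      rw [Algebra.smul_def, vE.map_mul, hvE]
      exact h1.trans_le (le_add_of_nonneg_left hd)
    have h4 := (hnorm (Algebra.trace _ E (d • (c * a)))).2 (by
      rw [← hvtrE]
      exact vE.map_lt_add h3 (by rwa [hvσE])) 1 (by simp)
    rwa [mul_one] at h4

end Trace

noncomputable section

/-! ## Split families of sets, their duals and their barycenters -/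

section Split

variable {K : Type*} [Field K] {v : AddValuation K (WithTop ℝ)}
  {W : Type*} [AddCommGroup W] [Module K W] {W' : Type*} [AddCommGroup W'] [Module K W']
  {κ : Type*}

/-- The family `r ↦ ⨁ₖ {c | v(c) ≥ r + lₖ} bₖ`. -/
def splitSet (v : AddValuation K (WithTop ℝ)) (b : Module.Basis κ K W) (l : κ → ℝ) (r : ℝ) :
    Set W :=
  {x | ∀ k, ((r + l k : ℝ) : WithTop ℝ) ≤ v (b.repr x k)}

/-- The dual `r ↦ {x | B(x, A((-r)+)) ⊆ 𝔭}` of the family `A` for the pairing `B`. -/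
def sharp (v : AddValuation K (WithTop ℝ)) (B : W → W' → K) (A : ℝ → Set W') (r : ℝ) : Set W :=
  {x | ∀ y, (∃ s, -r < s ∧ y ∈ A s) → 0 < v (B x y)}

/-- Some basis splits the families `A`, `B` and `C`, the constants of `C` being the barycenters
of those of `A` and `B`. -/
def IsSplitBarycenter (v : AddValuation K (WithTop ℝ)) (t : ℝ) (A B C : ℝ → Set W) : Prop :=
  ∃ (n : ℕ) (b : Module.Basis (Fin n) K W) (l m : Fin n → ℝ),
    A = splitSet v b l ∧ B = splitSet v b m ∧ C = splitSet v b (t • l + (1 - t) • m)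

theorem LatticeFunction.splitBy_iff {n : ℕ} {b : Module.Basis (Fin n) K W} {l : Fin n → ℝ}
    {L : LatticeFunction v W} :
    L.SplitBy b l ↔ (fun r => (L.toFun r : Set W)) = splitSet v b l := by
  constructor
  · intro h
    ext r x
    exact h r x
  · intro h r x
    exact Set.ext_iff.1 (congrFun h r) x

theorem splitSet_reindex {κ' : Type*} (b : Module.Basis κ K W) (l : κ → ℝ) (e : κ ≃ κ') :
    splitSet v (b.reindex e) (l ∘ e.symm) = splitSet v b l := by
  ext r x
  simp only [splitSet, Set.mem_ofPred_eq, Function.comp_apply, Module.Basis.repr_reindex_apply]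
  exact e.symm.forall_congr_right (q := fun k => ((r + l k : ℝ) : WithTop ℝ) ≤ v (b.repr x k))

theorem isSplitBarycenter_of_fintype [Fintype κ] {t : ℝ} (b : Module.Basis κ K W) (l m : κ → ℝ) :
    IsSplitBarycenter v t (splitSet v b l) (splitSet v b m)
      (splitSet v b (t • l + (1 - t) • m)) := by
  let e := Fintype.equivFin κ
  refine ⟨_, b.reindex e, l ∘ e.symm, m ∘ e.symm, (splitSet_reindex b l e).symm,
    (splitSet_reindex b m e).symm, ?_⟩
  rw [← splitSet_reindex b _ e]
  rfl

theorem zero_mem_splitSet (b : Module.Basis κ K W) (l : κ → ℝ) (r : ℝ) :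
    (0 : W) ∈ splitSet v b l r := by
  intro k
  simp

/-- In dual bases the pairing is diagonal up to the unit `u`, so the dual is computed coordinate by
coordinate. Strict positivity against all `s > -r` becomes the non-strict bound `v ≥ r - mₖ`. -/
theorem sharp_splitSet [Fintype κ] {σ : K →+* K} (hσ : ∀ x, v (σ x) = v x)
    {B : W → W' → K} {e : Module.Basis κ K W} {f : Module.Basis κ K W'} {u : K} (hu : v u = 0)
    (hB : ∀ x y, B x y = ∑ k, u * (σ (e.repr x k) * f.repr y k)) (m : κ → ℝ) :
    sharp v B (splitSet v f m) = splitSet v e (-m) := by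
  classical
  ext r x
  constructor
  · intro hx k
    by_contra hlt
    push Not at hlt
    have h0 : e.repr x k ≠ 0 := by
      intro h0
      simp [h0] at hlt
    have h0' : σ (e.repr x k) ≠ 0 := (map_ne_zero σ).2 h0
    obtain ⟨ρ, hρ⟩ := WithTop.ne_top_iff_exists.1 (v.ne_top_iff.2 h0)
    rw [← hρ] at hlt
    have hlt' : ρ < r + -m k := by exact_mod_cast hlt
    -- If the `k`-th coordinate of `x` has too small a value, this vector lies in the family at an
    -- index above `-r` and pairs with `x` to the unit `u`.
    have h1 := hx ((σ (e.repr x k))⁻¹ • f k) ⟨-ρ - m k, by linarith, fun j => by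
      by_cases hj : k = j
      · subst hj
        have h2 : f.repr ((σ (e.repr x k))⁻¹ • f k) k = (σ (e.repr x k))⁻¹ := by simp
        rw [h2, v.map_inv, hσ, ← hρ]
        exact_mod_cast (by linarith : -ρ - m k + m k ≤ -ρ)
      · have h2 : f.repr ((σ (e.repr x k))⁻¹ • f k) j = 0 := by
          simp [hj]
        rw [h2, v.map_zero]
        exact le_top⟩
    rw [hB, Finset.sum_eq_single k (fun j _ hj => by simp [Ne.symm hj])
      (by simp)] at h1
    have h3 : u * (σ (e.repr x k) * f.repr ((σ (e.repr x k))⁻¹ • f k) k) = u := by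
      simp [h0]
    rw [h3, hu] at h1
    exact lt_irrefl _ h1
  · rintro hx y ⟨s, hs, hy⟩
    rw [hB]
    refine v.map_lt_sum (by simp) fun k _ => ?_
    rw [v.map_mul, v.map_mul, hu, hσ, zero_add]
    have h1 := add_le_add (hx k) (hy k)
    refine lt_of_lt_of_le ?_ h1
    rw [← WithTop.coe_add]
    have h2 : (0 : ℝ) < r + (-m) k + (s + m k) := by
      rw [Pi.neg_apply]
      linarith
    exact_mod_cast h2

/-- One dual basis serves all three families, and negating constants commutes with barycenters. As
the splitting basis is not known in advance, `hB` provides a dual of every basis. -/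
theorem IsSplitBarycenter.sharp {σ : K →+* K} (hσ : ∀ x, v (σ x) = v x) {t : ℝ}
    {A₁ A₂ A₃ : ℝ → Set W'} (h : IsSplitBarycenter v t A₁ A₂ A₃) {B : W → W' → K} {u : K}
    (hu : v u = 0)
    (hB : ∀ (n : ℕ) (f : Module.Basis (Fin n) K W'), ∃ e : Module.Basis (Fin n) K W,
      ∀ x y, B x y = ∑ k, u * (σ (e.repr x k) * f.repr y k)) :
    IsSplitBarycenter v t (sharp v B A₁) (BruhatTits.sharp v B A₂) (BruhatTits.sharp v B A₃) := by
  obtain ⟨n, f, l, m, rfl, rfl, rfl⟩ := h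
  obtain ⟨e, he⟩ := hB n f
  refine ⟨n, e, -l, -m, sharp_splitSet hσ hu he l, sharp_splitSet hσ hu he m, ?_⟩
  rw [sharp_splitSet hσ hu he]
  congr 1
  ext k
  simp
  ring

/-- Restriction of scalars from `L` to `K`, by means of an orthogonal basis of `L`. -/
theorem LatticeFunction.IsBarycenter.isSplitBarycenter {L : Type*} [Field L] [Algebra K L]
    {vL : AddValuation L (WithTop ℝ)} (hvL : ∀ x, vL (algebraMap K L x) = v x)
    {n : ℕ} {a : Module.Basis (Fin n) K L} (ha : IsOrthogonal v vL a)
    [Module L W] [IsScalarTower K L W] {t : ℝ} {M₁ M₂ M₃ : LatticeFunction vL W}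
    (h : LatticeFunction.IsBarycenter t M₁ M₂ M₃) :
    IsSplitBarycenter v t (fun r => (M₁.toFun r : Set W)) (fun r => (M₂.toFun r : Set W))
      (fun r => (M₃.toFun r : Set W)) := by
  obtain ⟨N, b, l, m, h1, h2, h3⟩ := h
  have hn : IsNorm v vL := isNorm_addValuation hvL
  choose ρ hρ using fun k => hn.exists_real (a.ne_zero k)
  have key : ∀ l : Fin N → ℝ, splitSet vL b l =
      splitSet v (a.smulTower b) (fun k => l k.2 - ρ k.1) := by
    intro l
    ext r x
    simp only [splitSet, Set.mem_ofPred_eq, Prod.forall, Module.Basis.smulTower_repr]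
    rw [forall_comm]
    refine forall_congr' fun j => ?_
    conv_lhs => rw [← a.sum_repr (b.repr x j)]
    rw [hn.le_sum_iff ha]
    refine forall_congr' fun i => ?_
    rw [hρ]
    induction v (a.repr (b.repr x j) i) using WithTop.recTopCoe with
    | top => simp
    | coe z => norm_cast; constructor <;> intro <;> linarith
  rw [LatticeFunction.splitBy_iff, key] at h1 h2 h3
  rw [h1, h2, h3]
  -- All constants are translated by the same `-ρ`, and translations preserve barycenters.
  convert isSplitBarycenter_of_fintype (v := v) (t := t) (a.smulTower b)
    (fun k => l k.2 - ρ k.1) (fun k => m k.2 - ρ k.1) using 2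
  ext k
  simp
  ring

/-- The lattice `⨁ₖ {c | v(c) ≥ r + lₖ} bₖ`. -/
def splitSubmodule (v : AddValuation K (WithTop ℝ)) (b : Module.Basis κ K W) (l : κ → ℝ) (r : ℝ) :
    Submodule (ringOfIntegers v) W where
  carrier := splitSet v b l r
  zero_mem' := zero_mem_splitSet b l r
  add_mem' := fun {x y} hx hy k => by
    rw [map_add, Finsupp.add_apply]
    exact v.map_le_add (hx k) (hy k)
  smul_mem' := fun c x hx k => by
    rw [Subring.smul_def, map_smul, Finsupp.smul_apply, smul_eq_mul, v.map_mul]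
    exact (hx k).trans (le_add_of_nonneg_left c.2)

/-- Each coordinate ball is principal by discreteness. The multiples `dₖ bₖ` are the generators that
make a split family a family of lattices. -/
theorem IsDiscreteVal.exists_smul_mem_splitSet (hd : IsDiscreteVal v) (b : Module.Basis κ K W)
    (l : κ → ℝ) (r : ℝ) : ∃ d : κ → K, (∀ k, d k ≠ 0) ∧
      (∀ k c, ((r + l k : ℝ) : WithTop ℝ) ≤ v c ↔ v (d k) ≤ v c) ∧
      ∀ k, d k • b k ∈ splitSet v b l r := by
  classical
  choose d hd0 hd using fun k => hd (r + l k)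
  refine ⟨d, hd0, hd, fun k j => ?_⟩
  by_cases hj : k = j
  · subst hj
    rw [hd, map_smul, Finsupp.smul_apply, b.repr_self, Finsupp.single_eq_same, smul_eq_mul, mul_one]
  · simp [hj]

/-- The lattice function split by the basis `b` with constants `l`. -/
def LatticeFunction.ofBasis [Fintype κ] (hd : IsDiscreteVal v) (b : Module.Basis κ K W)
    (l : κ → ℝ) : LatticeFunction v W :=
  { toFun := splitSubmodule v b l
    fg := fun r => by
      obtain ⟨d, hd0, hd, hmem⟩ := hd.exists_smul_mem_splitSet b l r
      refine Submodule.fg_def.2 ⟨Set.range fun k => d k • b k, Set.finite_range _, ?_⟩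
      apply le_antisymm
      · rw [Submodule.span_le]
        rintro _ ⟨k, rfl⟩
        exact hmem k
      · intro x hx
        rw [← b.sum_repr x]
        refine Submodule.sum_mem _ fun k _ => ?_
        have hk : 0 ≤ v (b.repr x k / d k) := by
          rw [v.map_div]
          have h1 := (hd k _).1 (hx k)
          obtain ⟨ρ, hρ⟩ := WithTop.ne_top_iff_exists.1 (v.ne_top_iff.2 (hd0 k))
          rw [← hρ] at h1 ⊢
          revert h1
          induction v (b.repr x k) using WithTop.recTopCoe with
          | top => intro; exact le_top
          | coe z =>
            intro h1
            have h2 : ρ ≤ z := by exact_mod_cast h1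
            have h3 : (0 : ℝ) ≤ z - ρ := by linarith
            exact_mod_cast h3
        have h2 : b.repr x k • b k =
            (⟨b.repr x k / d k, hk⟩ : ringOfIntegers v) • (d k • b k) := by
          rw [Subring.smul_def, smul_smul, div_mul_cancel₀ _ (hd0 k)]
        rw [h2]
        exact Submodule.smul_mem _ _ (Submodule.subset_span ⟨k, rfl⟩)
    span_eq_top := fun r => by
      obtain ⟨d, hd0, -, hmem⟩ := hd.exists_smul_mem_splitSet b l r
      rw [eq_top_iff, ← b.span_eq, Submodule.span_le]
      rintro _ ⟨k, rfl⟩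
      have h2 := Submodule.smul_mem _ (d k)⁻¹ (Submodule.subset_span (R := K) (hmem k))
      rwa [inv_smul_smul₀ (hd0 k)] at h2
    anti := fun r s hrs x hx k => le_trans (by
      have h1 : s + l k ≤ r + l k := by linarith
      exact_mod_cast h1) (hx k)
    scale := fun c s hc r x => by
      refine forall_congr' fun k => ?_
      rw [map_smul, Finsupp.smul_apply, smul_eq_mul, v.map_mul, hc]
      induction v (b.repr x k) using WithTop.recTopCoe with
      | top => simp
      | coe z => norm_cast; constructor <;> intro <;> linarith
    left_cont := fun r x hx k => by
      have h1 : ∀ s < r, ((s + l k : ℝ) : WithTop ℝ) ≤ v (b.repr x k) := fun s hs => hx s hs k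
      revert h1
      induction v (b.repr x k) using WithTop.recTopCoe with
      | top => intro; exact le_top
      | coe z =>
        intro h1
        have h2 : r ≤ z - l k := le_of_forall_lt fun s hs => by
          obtain ⟨s', hs', hs''⟩ := exists_between hs
          have h3 : s' + l k ≤ z := by exact_mod_cast h1 s' hs''
          linarith
        have h3 : r + l k ≤ z := by linarith
        exact_mod_cast h3 }

theorem LatticeFunction.coe_ofBasis [Fintype κ] (hd : IsDiscreteVal v) (b : Module.Basis κ K W)
    (l : κ → ℝ) (r : ℝ) :
    ((LatticeFunction.ofBasis hd b l).toFun r : Set W) = splitSet v b l r := rfl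

end Split

/-! ## Dual bases for a sesquilinear form -/

section DualBasis

variable {K : Type*} [Field K] {σ : K →+* K} {V : Type*} [AddCommGroup V] [Module K V]
  (h : V →ₛₗ[σ] V →ₗ[K] K) {P Q : Submodule K V}

/-- The functionals on `Q` defined by a family of vectors of `P`. -/
def pairingMap {n : ℕ} (e : Fin n → P) : Q →ₗ[K] (Fin n → K) :=
  LinearMap.pi fun k => (h (e k)).comp Q.subtype

variable {h}

theorem pairingMap_injective (hPQ : ∀ y ∈ Q, (∀ x ∈ P, h x y = 0) → y = 0) {n : ℕ}
    (e : Module.Basis (Fin n) K P) :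
    Function.Injective (pairingMap h e : Q →ₗ[K] (Fin n → K)) := by
  rw [← LinearMap.ker_eq_bot, LinearMap.ker_eq_bot']
  intro y hy
  refine Subtype.ext (hPQ y y.2 fun x hx => ?_)
  have h1 := congrArg Subtype.val (e.sum_repr ⟨x, hx⟩)
  simp only [AddSubmonoidClass.coe_finsetSum, Submodule.coe_smul] at h1
  rw [← h1, map_sum, LinearMap.sum_apply]
  refine Finset.sum_eq_zero fun k _ => ?_
  have h2 : h (e k) y = 0 := congrFun hy k
  rw [map_smulₛₗ, LinearMap.smul_apply, h2, smul_zero]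

theorem finrank_le_of_pairing [FiniteDimensional K V] (hPQ : ∀ y ∈ Q, (∀ x ∈ P, h x y = 0) → y = 0) :
    Module.finrank K Q ≤ Module.finrank K P := by
  simpa using LinearMap.finrank_le_finrank_of_injective
    (pairingMap_injective hPQ (Module.finBasis K P))

/-- Nondegeneracy on both sides forces equal dimensions, so the injective map `pairingMap` is an
isomorphism. The dual basis is the preimage of the standard one. -/
theorem exists_dual_basis [FiniteDimensional K V] (hPQ : ∀ y ∈ Q, (∀ x ∈ P, h x y = 0) → y = 0)
    (hQP : ∀ y ∈ P, (∀ x ∈ Q, h x y = 0) → y = 0) {n : ℕ} (e : Module.Basis (Fin n) K P) :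
    ∃ f : Module.Basis (Fin n) K Q, ∀ k j, h (e k) (f j) = if k = j then 1 else 0 := by
  have hfr : Module.finrank K Q = Module.finrank K (Fin n → K) := by
    rw [le_antisymm (finrank_le_of_pairing hPQ) (finrank_le_of_pairing hQP),
      Module.finrank_eq_card_basis e, Module.finrank_fin_fun, Fintype.card_fin]
  let Φ := LinearEquiv.ofInjectiveOfFinrankEq (pairingMap h e : Q →ₗ[K] (Fin n → K))
    (pairingMap_injective hPQ e) hfr
  refine ⟨Module.Basis.ofEquivFun Φ, fun k j => ?_⟩
  have h1 : Φ (Module.Basis.ofEquivFun Φ j) k = (Pi.single j 1 : Fin n → K) k := by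
    rw [Module.Basis.coe_ofEquivFun, LinearEquiv.apply_symm_apply]
  rw [Pi.single_apply] at h1
  exact h1

theorem pairing_eq_sum {n : ℕ} {e : Module.Basis (Fin n) K P} {f : Module.Basis (Fin n) K Q} {u : K}
    (hef : ∀ k j, h (e k) (f j) = if k = j then u else 0) (x : P) (y : Q) :
    h x y = ∑ k, u * (σ (e.repr x k) * f.repr y k) := by
  have hx := congrArg Subtype.val (e.sum_repr x)
  have hy := congrArg Subtype.val (f.sum_repr y)
  simp only [AddSubmonoidClass.coe_finsetSum, Submodule.coe_smul] at hx hy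
  conv_lhs => rw [← hx, ← hy]
  rw [map_sum h, LinearMap.sum_apply]
  refine Finset.sum_congr rfl fun k _ => ?_
  rw [map_sum, Finset.sum_eq_single k]
  · rw [map_smul, map_smulₛₗ h, LinearMap.smul_apply, hef, if_pos rfl, smul_eq_mul, smul_eq_mul]
    ring
  · intro j _ hj
    rw [map_smul, map_smulₛₗ h, LinearMap.smul_apply, hef, if_neg (Ne.symm hj), smul_zero, smul_zero]
  · simp

end DualBasis

/-! ## The decomposition of `V` -/

section Decomposition

variable {F : Type*} [Field F] {V : Type*} [AddCommGroup V] [Module F V]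
  {β : Module.End F V} {ι : Type*} [DecidableEq ι] {E : ι → Type*} [∀ i, Field (E i)]
  [∀ i, Algebra F (E i)] (φ : Algebra.adjoin F {β} ≃ₐ[F] (∀ i, E i))

theorem coe_smul_component (i : ι) (a : E i) (x : component φ i) :
    ((a • x : component φ i) : V) = embed φ i a x := rfl

theorem coe_proj (i : ι) (x : V) : (proj φ i x : V) = idem φ i x := rfl

instance component_isScalarTower (i : ι) : IsScalarTower F (E i) (component φ i) where
  smul_assoc c a x := by
    apply Subtype.ext
    rw [Submodule.coe_smul, coe_smul_component, coe_smul_component]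
    have h : embed φ i (c • a) = c • embed φ i a := by
      simp [embed, Pi.single_smul]
    rw [h]
    rfl

theorem idem_idem_self (i : ι) (x : V) : idem φ i (idem φ i x) = idem φ i x := by
  have h := embed_mul φ i 1 1
  rw [one_mul] at h
  exact (LinearMap.congr_fun h x).symm

theorem idem_idem_of_ne {i j : ι} (hij : i ≠ j) (x : V) : idem φ i (idem φ j x) = 0 := by
  have h : (Pi.single i 1 : ∀ i, E i) * Pi.single j 1 = 0 := by
    ext k
    by_cases hk : k = i
    · subst hk
      simp [hij]
    · simp [hk]
  have h1 : idem φ i * idem φ j = 0 := by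
    rw [idem, idem, embed, embed, ← MulMemClass.coe_mul, ← map_mul, h, map_zero,
      ZeroMemClass.coe_zero]
  exact LinearMap.congr_fun h1 x

theorem sum_idem [Fintype ι] (x : V) : ∑ i, idem φ i x = x := by
  have h : ∑ i, idem φ i = 1 := by
    simp only [idem, embed]
    rw [← AddSubmonoidClass.coe_finsetSum, ← map_sum]
    have h1 : ∑ i, (Pi.single i 1 : ∀ i, E i) = 1 :=
      Finset.univ_sum_single (1 : ∀ i, E i)
    rw [h1, map_one, OneMemClass.coe_one]
  rw [← LinearMap.sum_apply, h]
  rfl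

theorem idem_coe_component (i : ι) (x : component φ i) : idem φ i x = x := by
  obtain ⟨_, u, rfl⟩ := x
  exact idem_idem_self φ i u

theorem idem_coe_component_of_ne {i j : ι} (hij : i ≠ j) (x : component φ j) :
    idem φ i x = 0 := by
  obtain ⟨_, u, rfl⟩ := x
  exact idem_idem_of_ne φ hij u

theorem exists_ne_zero_component (i : ι) : ∃ x : component φ i, x ≠ 0 := by
  by_contra hall
  push Not at hall
  have h1 : idem φ i = 0 := by
    ext x
    exact congrArg Subtype.val (hall (proj φ i x))
  have h2 : φ.symm (Pi.single i 1) = 0 := Subtype.ext h1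
  rw [map_eq_zero_iff _ φ.symm.injective, Pi.single_eq_zero_iff] at h2
  exact one_ne_zero h2

/-- The isomorphism `V ≃ ∏ᵢ Vᵢ`. -/
def componentEquiv [Fintype ι] : V ≃ₗ[F] ∀ i, component φ i where
  toFun x i := proj φ i x
  map_add' x y := funext fun i => Subtype.ext (map_add (idem φ i) x y)
  map_smul' c x := funext fun i => Subtype.ext (map_smul (idem φ i) c x)
  invFun y := ∑ i, (y i : V)
  left_inv x := sum_idem φ x
  right_inv y := by
    funext i
    apply Subtype.ext
    rw [coe_proj, map_sum, Finset.sum_eq_single i]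
    · exact idem_coe_component φ i (y i)
    · exact fun j _ hj => idem_coe_component_of_ne φ (Ne.symm hj) (y j)
    · simp

/-- The union of the splitting bases of the components splits the sums, with the same constants. -/
theorem IsSplitBarycenter.directSum [Fintype ι] {v : AddValuation F (WithTop ℝ)} {t : ℝ}
    {A B C : ∀ i, ℝ → Set (component φ i)} (h : ∀ i, IsSplitBarycenter v t (A i) (B i) (C i)) :
    IsSplitBarycenter v t (directSum φ A) (BruhatTits.directSum φ B)
      (BruhatTits.directSum φ C) := by
  choose n b l m hA hB hC using h
  have key : ∀ (D : ∀ i, ℝ → Set (component φ i)) (l : ∀ i, Fin (n i) → ℝ),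
      (∀ i, D i = splitSet v (b i) (l i)) → BruhatTits.directSum φ D =
        splitSet v ((Pi.basis b).map (componentEquiv φ).symm) (fun k => l k.1 k.2) := by
    intro D l hD
    ext r x
    simp only [BruhatTits.directSum, Set.mem_ofPred_eq, hD, splitSet, Module.Basis.map_repr,
      LinearEquiv.trans_apply, Pi.basis_repr, LinearEquiv.symm_symm, Sigma.forall]
    rfl
  rw [key A l hA, key B m hB, key C _ hC]
  exact isSplitBarycenter_of_fintype _ _ _

/-! ### The components with respect to the form -/

section Form

variable {φ} {σ : F →+* F} {h : V →ₛₗ[σ] V →ₗ[F] F} {ε : ℤˣ} {neg : ι → ι}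

theorem eq_zero_of_forall_component (hh : IsEpsHermitian ε h) (hnd : ∀ x, (∀ y, h x y = 0) → x = 0)
    (hneg : ∀ i x y, h (idem φ i x) y = h x (idem φ (neg i) y)) {i j : ι} (hj : neg i = j) (y : V)
    (hy : y ∈ component φ j) (hxy : ∀ x ∈ component φ i, h x y = 0) : y = 0 := by
  subst hj
  refine hnd y fun z => ?_
  have h1 : h z y = 0 := by
    have h2 : idem φ (neg i) y = y := idem_coe_component φ (neg i) ⟨y, hy⟩
    rw [← h2, ← hneg]
    exact hxy _ ⟨z, rfl⟩
  rw [hh z y, h1, map_zero, mul_zero]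

/-- Taking adjoints twice is the identity for an `ε`-hermitian form, so `i` and `-(-i)` have the
same idempotent. Distinct idempotents are orthogonal and non-zero. -/
theorem neg_neg_index (hh : IsEpsHermitian ε h) (hnd : ∀ x, (∀ y, h x y = 0) → x = 0)
    (hneg : ∀ i x y, h (idem φ i x) y = h x (idem φ (neg i) y)) (i : ι) : neg (neg i) = i := by
  have h1 : ∀ x, idem φ i x = idem φ (neg (neg i)) x := by
    intro x
    rw [← sub_eq_zero]
    refine hnd _ fun y => ?_
    rw [map_sub, LinearMap.sub_apply, hneg, hh (idem φ (neg i) y) x, hneg, ← hh, sub_self]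
  by_contra hne
  obtain ⟨x, hx⟩ := exists_ne_zero_component φ i
  apply hx
  apply Subtype.ext
  have h2 := h1 x
  rw [idem_coe_component, idem_coe_component_of_ne φ hne] at h2
  exact h2

theorem form_eq_sum [Fintype ι] (hneg : ∀ i x y, h (idem φ i x) y = h x (idem φ (neg i) y))
    (x y : V) : h x y = ∑ i, h (proj φ i x) (proj φ (neg i) y) := by
  conv_lhs => rw [← sum_idem φ x, map_sum, LinearMap.sum_apply]
  refine Finset.sum_congr rfl fun i _ => ?_
  rw [coe_proj, coe_proj, ← hneg, idem_idem_self]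

/-- The map induced by the adjunction on `Eᵢ` is an involution. -/
theorem adjoint_adjoint (hh : IsEpsHermitian ε h) (hnd : ∀ x, (∀ y, h x y = 0) → x = 0)
    (hneg : ∀ i x y, h (idem φ i x) y = h x (idem φ (neg i) y)) {i : ι} (hi : neg i = i)
    {τ : E i → E i} (hτ : ∀ (a : E i) (x y : component φ i),
      h ((a • x : component φ i) : V) y = h x ((τ a • y : component φ i) : V)) (a : E i) :
    τ (τ a) = a := by
  obtain ⟨y, hy⟩ := exists_ne_zero_component φ i
  rw [← sub_eq_zero]
  refine (smul_eq_zero.1 (Subtype.ext ?_)).resolve_right hy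
  refine eq_zero_of_forall_component hh hnd hneg hi _ (Subtype.property _) fun x hx => ?_
  have h1 := hτ (τ a) ⟨x, hx⟩ y
  rw [hh y, ← hτ, ← hh] at h1
  rw [sub_smul, Submodule.coe_sub, map_sub, ← h1, sub_self]

/-- The dual basis is taken for `h y x`, with `y` in `Vⱼ`; exchanging the arguments introduces the
factor `ε`. Both orders are recorded because biduality uses the same pair of bases twice. -/
theorem exists_component_basis_pairing [FiniteDimensional F V] (hh : IsEpsHermitian ε h)
    (hnd : ∀ x, (∀ y, h x y = 0) → x = 0)
    (hneg : ∀ i x y, h (idem φ i x) y = h x (idem φ (neg i) y)) {i j : ι} (hj : neg i = j) (n : ℕ)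
    (f : Module.Basis (Fin n) F (component φ j)) : ∃ e : Module.Basis (Fin n) F (component φ i),
      (∀ (x : component φ i) (y : component φ j),
        h x y = ∑ k, ((ε : ℤ) : F) * (σ (e.repr x k) * f.repr y k)) ∧
      ∀ (x : component φ i) (y : component φ j),
        h y x = ∑ k, 1 * (σ (f.repr y k) * e.repr x k) := by
  have hj' : neg j = i := by rw [← hj, neg_neg_index hh hnd hneg]
  obtain ⟨e, he⟩ := exists_dual_basis (h := h) (P := component φ j) (Q := component φ i)
    (fun y => eq_zero_of_forall_component hh hnd hneg hj' y)
    (fun y => eq_zero_of_forall_component hh hnd hneg hj y) f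
  refine ⟨e, pairing_eq_sum fun k j => ?_, fun x y => pairing_eq_sum he y x⟩
  rw [hh (f j) (e k), he]
  by_cases hkj : k = j
  · simp [hkj]
  · simp [hkj, Ne.symm hkj]

theorem val_units_int (v : AddValuation F (WithTop ℝ)) (ε : ℤˣ) : v ((ε : ℤ) : F) = 0 := by
  rcases Int.units_eq_one_or ε with rfl | rfl <;> simp [v.map_neg]

theorem isSplitBarycenter_sharp_component [FiniteDimensional F V] {v : AddValuation F (WithTop ℝ)}
    (hσ : ∀ x, v (σ x) = v x) (hh : IsEpsHermitian ε h) (hnd : ∀ x, (∀ y, h x y = 0) → x = 0)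
    (hneg : ∀ i x y, h (idem φ i x) y = h x (idem φ (neg i) y)) {i j : ι} (hj : neg i = j) {t : ℝ}
    {A B C : ℝ → Set (component φ j)} (H : IsSplitBarycenter v t A B C) :
    IsSplitBarycenter v t (sharp v (fun (x : component φ i) (y : component φ j) => h x y) A)
      (sharp v (fun (x : component φ i) (y : component φ j) => h x y) B)
      (sharp v (fun (x : component φ i) (y : component φ j) => h x y) C) := by
  refine H.sharp hσ (val_units_int v ε) fun n f => ?_
  obtain ⟨e, he, -⟩ := exists_component_basis_pairing hh hnd hneg hj n f
  exact ⟨e, he⟩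

/-- Each dual negates the constants of a splitting. The hypothesis `H` serves only to say that `A`
is split. -/
theorem sharp_sharp_component [FiniteDimensional F V] {v : AddValuation F (WithTop ℝ)}
    (hσ : ∀ x, v (σ x) = v x) (hh : IsEpsHermitian ε h) (hnd : ∀ x, (∀ y, h x y = 0) → x = 0)
    (hneg : ∀ i x y, h (idem φ i x) y = h x (idem φ (neg i) y)) {i j : ι} (hj : neg i = j) {t : ℝ}
    {A B C : ℝ → Set (component φ j)} (H : IsSplitBarycenter v t A B C) :
    sharp v (fun (y : component φ j) (x : component φ i) => h y x)
      (sharp v (fun (x : component φ i) (y : component φ j) => h x y) A) = A := by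
  obtain ⟨n, f, l, m, rfl, -, -⟩ := H
  obtain ⟨e, he, he'⟩ := exists_component_basis_pairing hh hnd hneg hj n f
  rw [sharp_splitSet hσ (val_units_int v ε) he,
    sharp_splitSet hσ v.map_one (e := f) (f := e) (fun y x => he' x y), neg_neg]

/-- A direct sum of components which are dual in pairs is self-dual. -/
theorem mem_directSum_iff_of_sharp [Fintype ι] {v : AddValuation F (WithTop ℝ)}
    (hneg : ∀ i x y, h (idem φ i x) y = h x (idem φ (neg i) y))
    {A : ∀ i, ℝ → Set (component φ i)} (h0 : ∀ i r, 0 ∈ A i r)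
    (hA : ∀ i, A i =
      sharp v (fun (x : component φ i) (y : component φ (neg i)) => h x y) (A (neg i)))
    (r : ℝ) (x : V) :
    x ∈ directSum φ A r ↔ ∀ y, (∃ s, -r < s ∧ y ∈ directSum φ A s) → 0 < v (h x y) := by
  constructor
  · rintro hx y ⟨s, hs, hy⟩
    rw [form_eq_sum hneg]
    refine v.map_lt_sum (by simp) fun i _ => ?_
    have h1 := hx i
    rw [hA] at h1
    exact h1 _ ⟨s, hs, hy (neg i)⟩
  · intro hx i
    rw [hA]
    rintro y ⟨s, hs, hy⟩
    -- It suffices to test against vectors of the single block `V₋ᵢ`; these lie in the direct sum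
    -- because every `A k s` contains 0.
    have h1 : ((y : V)) ∈ directSum φ A s := by
      intro k
      by_cases hk : k = neg i
      · subst hk
        have h2 : proj φ (neg i) y = y := Subtype.ext (idem_coe_component φ _ y)
        rwa [h2]
      · have h2 : proj φ k y = 0 := Subtype.ext (idem_coe_component_of_ne φ hk y)
        rw [h2]
        exact h0 k s
    have h2 := hx y ⟨s, hs, h1⟩
    rwa [← idem_coe_component φ (neg i) y, ← hneg] at h2

end Form

/-! ### The three cases of `iotaMap` -/

section Iota

variable {φ} {σ : F →+* F} {h : V →ₛₗ[σ] V →ₗ[F] F} {v : AddValuation F (WithTop ℝ)}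
  {vE : ∀ i, AddValuation (E i) (WithTop ℝ)} {neg : ι → ι} {Jp : Set ι}
  {L₀ : ∀ i : {i // neg i = i}, LatticeFunction (vE i) (component φ i)}
  {Lp : ∀ i : Jp, LatticeFunction (vE i) (component φ i)}

theorem iotaMap_of_neg_eq {i : ι} (hi : neg i = i) :
    iotaMap φ h v vE neg Jp L₀ Lp i = fun r => ((L₀ ⟨i, hi⟩).toFun r : Set (component φ i)) := by
  ext r x
  rw [iotaMap, dif_pos hi]

theorem iotaMap_of_mem {i : ι} (hi : neg i ≠ i) (hp : i ∈ Jp) :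
    iotaMap φ h v vE neg Jp L₀ Lp i = fun r => ((Lp ⟨i, hp⟩).toFun r : Set (component φ i)) := by
  ext r x
  rw [iotaMap, dif_neg hi, dif_pos hp]

theorem iotaMap_of_neg_mem {i : ι} (hi : neg i ≠ i) (hp : i ∉ Jp) (hn : neg i ∈ Jp) :
    iotaMap φ h v vE neg Jp L₀ Lp i =
      sharp v (fun (x : component φ i) (y : component φ (neg i)) => h x y)
        (fun r => ((Lp ⟨neg i, hn⟩).toFun r : Set (component φ (neg i)))) := by
  ext r x
  rw [iotaMap, dif_neg hi, dif_neg hp, dif_pos hn]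
  rfl

end Iota

end Decomposition

end

/-- Separation makes compact sets closed, which the intersection argument for best approximation
requires. -/
theorem _root_.IsNonarchimedeanLocalField.t2Space (K : Type*) [Field K] [ValuativeRel K]
    [TopologicalSpace K] [IsNonarchimedeanLocalField K] : T2Space K := by
  let := IsTopologicalAddGroup.rightUniformSpace K
  have := isUniformAddGroup_of_addCommGroup (G := K)
  exact inferInstance

/-! ### Splitting and duality of the lattice functions attached to points -/

section Identification

variable {K : Type*} [Field K] {v : AddValuation K (WithTop ℝ)} {W : Type*} [AddCommGroup W]
  [Module K W]

/-- Every lattice function attached to a point of the building is split by a basis. -/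
theorem Building.IsIdentification.isBarycenter_self {σ : K →+* K} {h : W →ₛₗ[σ] W →ₗ[K] K}
    {w : WittDecomposition h} {j : Building v w → {L : LatticeFunction v W // L.IsSelfDual h}}
    (hj : Building.IsIdentification j) (x : Building v w) :
    LatticeFunction.IsBarycenter 1 (j x).1 (j x).1 (j x).1 := by
  -- A barycenter relation between lattice functions contains a common splitting basis, so splitting
  -- follows from affineness applied to the trivial relation of a point with itself.
  rw [← hj.affine 1 zero_le_one le_rfl]
  obtain ⟨⟨g, p⟩, rfl⟩ := Quot.exists_rep x
  exact ⟨g, p, p, rfl, rfl, by simp; rfl⟩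

/-- Every lattice function attached to a point of the enlarged building is split by a basis. -/
theorem GLBuilding.IsIdentification.isBarycenter_self {n : ℕ} {b : Module.Basis (Fin n) K W}
    {j : GLBuilding v b → LatticeFunction v W} (hj : GLBuilding.IsIdentification j)
    (x : GLBuilding v b) : LatticeFunction.IsBarycenter 1 (j x) (j x) (j x) := by
  rw [← hj.affine 1 zero_le_one le_rfl]
  obtain ⟨⟨g, p⟩, rfl⟩ := Quot.exists_rep x
  exact ⟨g, p, p, rfl, rfl, by simp; rfl⟩

/-- A lattice function which is self-dual for `f` is self-dual for `λ ∘ f`, if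
`{a | λ(a 𝔬) ⊆ 𝔭} = 𝔭`. -/
theorem LatticeFunction.IsSelfDual.eq_sharp {σ : K →+* K} {f : W →ₛₗ[σ] W →ₗ[K] K}
    {L : LatticeFunction v W} (hL : L.IsSelfDual f) {F : Type*} [Field F]
    {vF : AddValuation F (WithTop ℝ)} {lam : K → F}
    (hlam : ∀ a, (∀ c, 0 ≤ v c → 0 < vF (lam (c * a))) ↔ 0 < v a) :
    (fun r => (L.toFun r : Set W)) =
      sharp vF (fun x y => lam (f x y)) (fun r => (L.toFun r : Set W)) := by
  ext r x
  refine (hL r x).trans ⟨?_, fun H y hy => ?_⟩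
  · intro H y hy
    have h1 := (hlam _).2 (H y hy) 1 (by simp)
    rwa [one_mul] at h1
  · rw [← hlam]
    intro c hc
    obtain ⟨s, hs, hys⟩ := hy
    -- The integral multiples of `f x y` needed for `hlam` are values of `f` on multiples of `y`,
    -- which stay in the lattice.
    have h1 := H (c • y) ⟨s, hs, (L.toFun s).smul_mem ⟨c, hc⟩ hys⟩
    simpa only [map_smul, smul_eq_mul] using h1

end Identification

end BruhatTits

/-! ### Assembly of the proof -/

theorem proposition7p1
    -- the non-archimedean local field `F₀`, of residual characteristic not `2`, with its normalized
    -- valuation `v₀`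
    {F₀ : Type*} [Field F₀] [ValuativeRel F₀] [TopologicalSpace F₀] [IsNonarchimedeanLocalField F₀]
    (v₀ : AddValuation F₀ (WithTop ℝ))
    (hv₀ : ∀ x y : F₀, ValuativeRel.vle x y ↔ v₀ y ≤ v₀ x)
    (hv₀_int : ∀ x : F₀, x ≠ 0 → ∃ k : ℤ, v₀ x = ((k : ℝ) : WithTop ℝ))
    (hv₀_one : ∃ x : F₀, v₀ x = ((1 : ℝ) : WithTop ℝ))
    (hres : v₀ 2 = 0)
    -- the extension `F / F₀` with its Galois group generated by `σ`, and the extension of `v₀`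
    {F : Type*} [Field F] [Algebra F₀ F] [FiniteDimensional F₀ F] [IsGalois F₀ F]
    (hF : Module.finrank F₀ F ≤ 2)
    (σ : F ≃ₐ[F₀] F) (hσ : ∀ τ : F ≃ₐ[F₀] F, τ ∈ Subgroup.zpowers σ)
    (v : AddValuation F (WithTop ℝ)) (hv : ∀ x : F₀, v (algebraMap F₀ F x) = v₀ x)
    -- the non-degenerate `ε`-hermitian space `(V, h)`
    {V : Type*} [AddCommGroup V] [Module F V] [FiniteDimensional F V]
    (ε : ℤˣ) (h : V →ₛₗ[(σ : F →+* F)] V →ₗ[F] F)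
    (hh : IsEpsHermitian ε h) (hnd : ∀ x, (∀ y, h x y = 0) → x = 0)
    -- the element `β` of the Lie algebra, and the decomposition of `F[β]` as a sum of fields
    (β : Module.End F V) (hβ : ∀ x y, h (β x) y + h x (β y) = 0)
    {ι : Type*} [Fintype ι] [DecidableEq ι] {E : ι → Type*} [∀ i, Field (E i)]
    [∀ i, Algebra F (E i)] [∀ i, Algebra F₀ (E i)] [∀ i, IsScalarTower F₀ F (E i)]
    (φ : Algebra.adjoin F {β} ≃ₐ[F] (∀ i, E i))
    -- the labelling: `neg i` is the index `-i`, so that `𝟏₋ᵢ` is the adjoint of `𝟏ᵢ`;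
    -- `J₀` is the set of `i` with `-i = i`; and `J₊` contains exactly one of `i`, `-i` if `-i ≠ i`
    (neg : ι → ι) (hneg : ∀ i x y, h (idem φ i x) y = h x (idem φ (neg i) y))
    (Jp : Set ι) (hJp_ne : ∀ i ∈ Jp, neg i ≠ i)
    (hJp : ∀ i, neg i ≠ i → (i ∈ Jp ↔ neg i ∉ Jp))
    -- the extensions of `v₀` to the `Eᵢ`
    (vE : ∀ i, AddValuation (E i) (WithTop ℝ)) (hvE : ∀ i (x : F), vE i (algebraMap F (E i) x) = v x)
    -- for `i ∈ J₀`, the involution `σᵢ` induced on `Eᵢ` by the adjunction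
    (σE : ∀ i : {i // neg i = i}, E i ≃ₐ[F₀] E i)
    (hσE : ∀ (i : {i // neg i = i}) (a : E i) (x y : component φ i.1),
      h ((a • x : component φ i.1) : V) y = h x ((σE i a • y : component φ i.1) : V))
    -- for `i ∈ J₀`, the non-zero `σ`-equivariant linear form `λᵢ`, the linear form `λᵢ⁰` on the
    -- fixed field `Eᵢ⁰` of `σᵢ` with `λᵢ⁰ ∘ Tr = Tr ∘ λᵢ`, and their normalization
    (lam : ∀ i : {i // neg i = i}, E i →ₗ[F] F) (hlam_ne : ∀ i, lam i ≠ 0)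
    (hlam : ∀ i a, lam i (σE i a) = σ (lam i a))
    (lam₀ : ∀ i : {i // neg i = i},
      IntermediateField.fixedField (Subgroup.zpowers (σE i)) →ₗ[F₀] F₀)
    (hlam₀ : ∀ (i : {i // neg i = i}) (a : E i),
      lam₀ i (Algebra.trace (IntermediateField.fixedField (Subgroup.zpowers (σE i))) (E i) a) =
        Algebra.trace F₀ F (lam i a))
    (hlam₀_norm : ∀ (i : {i // neg i = i})
      (a : IntermediateField.fixedField (Subgroup.zpowers (σE i))),
      (∀ c : IntermediateField.fixedField (Subgroup.zpowers (σE i)),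
        0 ≤ vE i (c : E i) → 0 < v₀ (lam₀ i (a * c))) ↔ 0 < vE i (a : E i))
    -- for `i ∈ J₀`, the `ε`-hermitian form `hᵢ` on `Vᵢ` with `h = λᵢ ∘ hᵢ`
    (hE : ∀ i : {i // neg i = i},
      component φ i.1 →ₛₗ[(σE i : E i →+* E i)] component φ i.1 →ₗ[E i] E i)
    (hhE : ∀ i, IsEpsHermitian ε (hE i))
    (hE_lam : ∀ (i : {i // neg i = i}) (x y : component φ i.1), h (x : V) y = lam i (hE i x y))
    -- the building `I` of the isometry group of `h`, and the identification `j_h`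
    (w : WittDecomposition h)
    (jh : Building v w → {L : LatticeFunction v V // L.IsSelfDual h})
    (hjh : Building.IsIdentification jh)
    -- for `i ∈ J₀`, the building of the isometry group of `hᵢ`, and the identification `j_{hᵢ}`
    (wE : ∀ i : {i // neg i = i}, WittDecomposition (hE i))
    (jhE : ∀ i : {i // neg i = i}, Building (vE i) (wE i) →
      {L : LatticeFunction (vE i) (component φ i.1) // L.IsSelfDual (hE i)})
    (hjhE : ∀ i, Building.IsIdentification (jhE i))
    -- for `i ∈ J₊`, the enlarged building of `GL(Vᵢ)`, and an identification `jᵢ`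
    (n : Jp → ℕ) (b : ∀ i : Jp, Module.Basis (Fin (n i)) (E i) (component φ i.1))
    (jE : ∀ i : Jp, GLBuilding (vE i) (b i) → LatticeFunction (vE i) (component φ i.1))
    (hjE : ∀ i, GLBuilding.IsIdentification (jE i)) :
    ∃! jβ : (∀ i : {i // neg i = i}, Building (vE i) (wE i)) ×
        (∀ i : Jp, GLBuilding (vE i) (b i)) → Building v w,
      -- `j_β = j_h⁻¹ ∘ (⨁) ∘ ι_h ∘ (∏ j_{hᵢ} × ∏ jᵢ)`
      (∀ x r, ((jh (jβ x)).1.toFun r : Set V) =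
        directSum φ (iotaMap φ h v vE neg Jp
          (fun i => (jhE i (x.1 i)).1) (fun i => jE i (x.2 i))) r) ∧
      -- `j_β` is affine
      ∀ t : ℝ, 0 ≤ t → t ≤ 1 → ∀ x y z,
        (∀ i, Building.IsBarycenter t (x.1 i) (y.1 i) (z.1 i)) →
        (∀ i, GLBuilding.IsBarycenter t (x.2 i) (y.2 i) (z.2 i)) →
        Building.IsBarycenter t (jβ x) (jβ y) (jβ z) := by
  have hd₀ : IsDiscreteVal v₀ := isDiscreteVal_of_int hv₀_int hv₀_one
  have : T2Space F₀ := IsNonarchimedeanLocalField.t2Space F₀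
  have hK := isCompact_le_val hv₀ hd₀
  have hdF : IsDiscreteVal v := hd₀.of_finite hK hv
  have hvσ : ∀ x, v (σ x) = v x := val_algEquiv hK hv σ
  -- The order of `σ` divides the degree, which is 1 or 2.
  have hσ2 : σ * σ = 1 := by
    have h1 : σ ^ Nat.card (F ≃ₐ[F₀] F) = 1 := pow_card_eq_one'
    rw [IsGalois.card_aut_eq_finrank] at h1
    have h0 : 0 < Module.finrank F₀ F := Module.finrank_pos
    obtain h2 | h2 : Module.finrank F₀ F = 1 ∨ Module.finrank F₀ F = 2 := by omega
    · rw [h2, pow_one] at h1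
      rw [h1, one_mul]
    · rwa [h2, pow_two] at h1
  have hfinE : ∀ i, FiniteDimensional F (E i) := fun i =>
    Module.Finite.of_surjective ((LinearMap.proj i).comp φ.toLinearMap)
      ((Function.surjective_eval i).comp φ.surjective)
  have hfinE₀ : ∀ i, FiniteDimensional F₀ (E i) := fun i => FiniteDimensional.trans F₀ F (E i)
  have hvE₀ : ∀ i (x : F₀), vE i (algebraMap F₀ (E i) x) = v₀ x := fun i x => by
    rw [IsScalarTower.algebraMap_apply F₀ F (E i), hvE, hv]
  have hlamn : ∀ (i : {i // neg i = i}) (a : E i),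
      (∀ c, 0 ≤ vE i c → 0 < v (lam i (c * a))) ↔ 0 < vE i a := fun i =>
    lam_normalized hv (hvE i) hres σ hσ hσ2 hvσ (σE i)
      (AlgEquiv.ext fun a => adjoint_adjoint hh hnd hneg i.2 (hσE i) a)
      (val_algEquiv hK (hvE₀ i) (σE i)) (lam i) (lam₀ i) (hlam₀ i) (hlam₀_norm i)
  choose a ha using fun i => exists_orthogonal_basis_of_tower hK hv (hvE i)
  have hnn : ∀ i, neg (neg i) = i := neg_neg_index hh hnd hneg
  let I := fun x : (∀ i : {i // neg i = i}, Building (vE i) (wE i)) ×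
      (∀ i : Jp, GLBuilding (vE i) (b i)) =>
    iotaMap φ h v vE neg Jp (fun i => (jhE i (x.1 i)).1) (fun i => jE i (x.2 i))
  have hbar : ∀ (t : ℝ) x y z,
      (∀ i, LatticeFunction.IsBarycenter t (jhE i (x.1 i)).1 (jhE i (y.1 i)).1 (jhE i (z.1 i)).1) →
      (∀ i, LatticeFunction.IsBarycenter t (jE i (x.2 i)) (jE i (y.2 i)) (jE i (z.2 i))) →
      ∀ i, IsSplitBarycenter v t (I x i) (I y i) (I z i) := by
    intro t x y z h₀ hp i
    by_cases hi : neg i = i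
    · simp only [I, iotaMap_of_neg_eq hi]
      exact (h₀ ⟨i, hi⟩).isSplitBarycenter (hvE i) (ha i)
    · by_cases hi' : i ∈ Jp
      · simp only [I, iotaMap_of_mem hi hi']
        exact (hp ⟨i, hi'⟩).isSplitBarycenter (hvE i) (ha i)
      · have hn : neg i ∈ Jp := not_not.1 (mt (hJp i hi).2 hi')
        simp only [I, iotaMap_of_neg_mem hi hi' hn]
        exact isSplitBarycenter_sharp_component hvσ hh hnd hneg rfl
          ((hp ⟨neg i, hn⟩).isSplitBarycenter (hvE _) (ha _))
  -- With `t = 1` this just says that every `I x i` is split over `F`.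
  have hself : ∀ x i, IsSplitBarycenter v 1 (I x i) (I x i) (I x i) := fun x =>
    hbar 1 x x x (fun i => (hjhE i).isBarycenter_self _) (fun i => (hjE i).isBarycenter_self _)
  have hdual : ∀ x i j, neg i = j → I x i =
      sharp v (fun (u : component φ i) (u' : component φ j) => h u u') (I x j) := by
    intro x i j hj
    by_cases hi : neg i = i
    · obtain rfl : i = j := hi.symm.trans hj
      simp only [I, iotaMap_of_neg_eq hi, hE_lam ⟨i, hi⟩]
      exact (jhE ⟨i, hi⟩ (x.1 ⟨i, hi⟩)).2.eq_sharp (hlamn ⟨i, hi⟩)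
    · have hji : neg j = i := by rw [← hj, hnn]
      have hj' : neg j ≠ j := fun h1 => hi (by rw [hj, ← h1, hji])
      by_cases hi' : i ∈ Jp
      · subst hji
        have hjp : j ∉ Jp := fun h1 => (hJp j hj').1 h1 hi'
        -- Here the component at `j` was defined as the dual of the one at `-j`, so the claim for
        -- `-j` is biduality.
        have h1 : I x j = sharp v
            (fun (u : component φ j) (u' : component φ (neg j)) => h u u') (I x (neg j)) := by
          simp only [I, iotaMap_of_neg_mem hj' hjp hi', iotaMap_of_mem hi hi']
        rw [h1, sharp_sharp_component hvσ hh hnd hneg rfl (hself x (neg j))]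
      · subst hj
        have hn : neg i ∈ Jp := not_not.1 (mt (hJp i hi).2 hi')
        simp only [I, iotaMap_of_neg_mem hi hi' hn, iotaMap_of_mem hj' hn]
  have hlatt : ∀ x, ∃ L : {L : LatticeFunction v V // L.IsSelfDual h},
      ∀ r, (L.1.toFun r : Set V) = directSum φ (I x) r := by
    intro x
    -- Being split by a basis is what makes the direct sum a lattice function over `F`.
    obtain ⟨N, e, l, -, hl, -, -⟩ := IsSplitBarycenter.directSum φ (hself x)
    have hL : ∀ r, ((LatticeFunction.ofBasis hdF e l).toFun r : Set V) =
        directSum φ (I x) r := fun r => by rw [LatticeFunction.coe_ofBasis, hl]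
    have hL' : ∀ r u, u ∈ (LatticeFunction.ofBasis hdF e l).toFun r ↔
        u ∈ directSum φ (I x) r := fun r u => Set.ext_iff.1 (hL r) u
    refine ⟨⟨LatticeFunction.ofBasis hdF e l, fun r u => ?_⟩, hL⟩
    have h0 : ∀ i r, 0 ∈ I x i r := fun i r => by
      obtain ⟨_, f, m, -, hm, -, -⟩ := hself x i
      rw [hm]
      exact zero_mem_splitSet f m r
    rw [hL', mem_directSum_iff_of_sharp hneg h0 (fun i => hdual x i _ rfl)]
    simp only [LatticeFunction.plus, Set.mem_ofPred_eq, hL']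
  choose Lx hLx using hlatt
  choose jβ hjβ using fun x => hjh.bijective.2 (Lx x)
  have hprop : ∀ x r, ((jh (jβ x)).1.toFun r : Set V) = directSum φ (I x) r := fun x r => by
    rw [hjβ, hLx]
  refine ⟨jβ, ⟨hprop, fun t ht0 ht1 x y z hB hGL => ?_⟩, fun j' hj' => ?_⟩
  · rw [hjh.affine t ht0 ht1]
    obtain ⟨N, e, l, m, hx, hy, hz⟩ := IsSplitBarycenter.directSum φ (hbar t x y z
      (fun i => ((hjhE i).affine t ht0 ht1 _ _ _).1 (hB i))
      (fun i => ((hjE i).affine t ht0 ht1 _ _ _).1 (hGL i)))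
    exact ⟨N, e, l, m, LatticeFunction.splitBy_iff.2 ((funext (hprop x)).trans hx),
      LatticeFunction.splitBy_iff.2 ((funext (hprop y)).trans hy),
      LatticeFunction.splitBy_iff.2 ((funext (hprop z)).trans hz)⟩
  -- The formula for `⨁ Λᵢ` and injectivity of `jh` already determine the map.
  · funext x
    refine hjh.bijective.1 (Subtype.ext (LatticeFunction.ext ?_))
    funext r
    exact SetLike.coe_injective ((hj'.1 x r).trans (hprop x r).symm)
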